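/- Let $P=p_1\cdots p_n$ and $Q=q_1\cdots q_n$ be two lattice paths from $(0,0)$ to $(m,r)$, $n=m+r$, with unit north ($N$) and east ($E$) steps, where $P$ never goes above $Q$. Let $l_1<\dots<l_r$ be the positions of the north steps of $Q$ and $u_1<\dots<u_r$ those of $P$, and let $M=M[P,Q]$ be the lattice path matroid on $[n]=\{1,\dots,n\}$, that is, the transversal matroid with presentation $([l_1,u_1],\dots,[l_r,u_r])$: a set $I\subseteq[n]$ is independent if and only if there is an injection $\phi:I\to[r]$ with $x\in[l_{\phi(x)},u_{\phi(x)}]$ for all $x\in I$. For a connected component $X$ of $M$, the initial connected flats of the restriction $M|X$ are the sets $\{i\in X: i\le a\}$ where $a,a+1\in X$, $q_a=E$ and $q_{a+1}=N$; the final connected flats of $M|X$ are the sets $\{i\in X: i\ge b\}$ where $b-1,b\in X$, $p_{b-1}=N$ and $p_b=E$. A pair $(A,B)$ of sets is modular in a matroid with rank function $\rho$ if $\rho(A)+\rho(B)=\rho(A\cup B)+\rho(A\cap B)$. A cyclic flat of a matroid is a flat that is a (possibly empty) union of circuits; ordered by inclusion, the cyclic flats form a lattice. The configuration of a finite matroid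 $K$ is a tuple $(L,s,\rho,|E(K)|)$, where $L$ is a lattice for which there is a lattice isomorphism $\varphi$ from $L$ onto the lattice of cyclic flats of $K$ such that $s(x)=|\varphi(x)|$ and $\rho(x)=r_K(\varphi(x))$ for all $x\in L$. Two finite matroids have the same configuration if some tuple is the configuration of both. A finite matroid $K$ is configuration unique if every finite matroid with the same configuration as $K$ is isomorphic to $K$. **Theorem.** Suppose that for every connected component $X$ of $M=M[P,Q]$, every initial connected flat $A$ of $M|X$ and every final connected flat $B$ of $M|X$, the pair $(A,B)$ is modular in $M|X$. Then $M$ is configuration unique. -/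

import Mathlib

/-! ### Transversal matroids -/

section Transversal

/-- `I` is a partial transversal of the set system `A`: there is an injection `φ : I → ι` with
`x ∈ A (φ x)` for all `x ∈ I`. -/
def IsPartialTransversal {α ι : Type*} (A : ι → Set α) (I : Set α) : Prop :=
  ∃ φ : I → ι, Function.Injective φ ∧ ∀ x : I, (x : α) ∈ A (φ x)

theorem isPartialTransversal_iff {α ι : Type*} [Nonempty ι] (A : ι → Set α) (I : Set α) :
    IsPartialTransversal A I ↔ ∃ f : α → ι, Set.InjOn f I ∧ ∀ x ∈ I, x ∈ A (f x) := by
  classical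
  constructor
  · rintro ⟨φ, hφ, hA⟩
    refine ⟨fun x => if h : x ∈ I then φ ⟨x, h⟩ else Classical.arbitrary ι, ?_, ?_⟩
    · intro x hx y hy hxy
      simp only [hx, hy, dif_pos] at hxy
      simpa using hφ hxy
    · intro x hx
      simpa only [hx, dif_pos] using hA ⟨x, hx⟩
  · rintro ⟨f, hf, hA⟩
    exact ⟨fun x => f x, fun x y hxy => Subtype.ext (hf x.2 y.2 hxy), fun x => hA x x.2⟩

theorem partialTransversal_augment_aux {α ι : Type*} [Finite α] (A : ι → Set α) {I J : Set α}
    (hcard : I.ncard < J.ncard) (g : α → ι) (hg : Set.InjOn g J) (hgA : ∀ x ∈ J, x ∈ A (g x))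
    (k : ℕ) : ∀ f : α → ι, Set.InjOn f I → (∀ x ∈ I, x ∈ A (f x)) →
      {x | x ∈ I ∧ x ∈ J ∧ f x ≠ g x}.ncard ≤ k →
      ∃ e ∈ J, e ∉ I ∧ ∃ f' : α → ι, Set.InjOn f' (insert e I) ∧
        ∀ x ∈ insert e I, x ∈ A (f' x) := by
  classical
  induction k with
  | zero =>
    intro f hf hfA hk
    have hlt : (f '' I).ncard < (g '' J).ncard := by
      rwa [hf.ncard_image, hg.ncard_image]
    obtain ⟨j, ⟨x, hxJ, rfl⟩, hjI⟩ := Set.exists_mem_notMem_of_ncard_lt_ncard hlt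
      (I.toFinite.image f)
    have hxI : x ∉ I := by
      intro hxI
      have hne : f x ≠ g x := fun h => hjI ⟨x, hxI, h⟩
      have : {x | x ∈ I ∧ x ∈ J ∧ f x ≠ g x} = ∅ :=
        (Set.ncard_eq_zero (Set.toFinite _)).1 (Nat.le_zero.1 hk)
      have hx : x ∈ {x | x ∈ I ∧ x ∈ J ∧ f x ≠ g x} := ⟨hxI, hxJ, hne⟩
      simp [this] at hx
    refine ⟨x, hxJ, hxI, Function.update f x (g x), ?_, ?_⟩
    · intro y hy z hz hyz
      grind [Function.update_apply, Set.InjOn]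
    · intro y hy
      grind [Function.update_apply]
  | succ k ih =>
    intro f hf hfA hk
    have hlt : (f '' I).ncard < (g '' J).ncard := by
      rwa [hf.ncard_image, hg.ncard_image]
    obtain ⟨j, ⟨x, hxJ, rfl⟩, hjI⟩ := Set.exists_mem_notMem_of_ncard_lt_ncard hlt
      (I.toFinite.image f)
    by_cases hxI : x ∈ I
    · have hne : f x ≠ g x := fun h => hjI ⟨x, hxI, h⟩
      refine ih (Function.update f x (g x)) ?_ ?_ ?_
      · intro y hy z hz hyz
        grind [Function.update_apply, Set.InjOn]
      · intro y hy
        grind [Function.update_apply]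
      · refine Nat.le_of_lt_succ (lt_of_lt_of_le (Set.ncard_lt_ncard ?_ (Set.toFinite _)) hk)
        refine (Set.ssubset_iff_of_subset ?_).2 ⟨x, ⟨hxI, hxJ, hne⟩, ?_⟩
        · intro y hy
          grind [Function.update_apply]
        · simp
    · refine ⟨x, hxJ, hxI, Function.update f x (g x), ?_, ?_⟩
      · intro y hy z hz hyz
        grind [Function.update_apply, Set.InjOn]
      · intro y hy
        grind [Function.update_apply]

theorem partialTransversal_augment {α ι : Type*} [Finite α] (A : ι → Set α) {I J : Set α}
    (hI : IsPartialTransversal A I) (hJ : IsPartialTransversal A J) (hcard : I.ncard < J.ncard) :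
    ∃ e ∈ J, e ∉ I ∧ IsPartialTransversal A (insert e I) := by
  have hne : J.Nonempty := Set.nonempty_of_ncard_ne_zero (by omega)
  obtain ⟨x, hx⟩ := hne
  have : Nonempty ι := ⟨hJ.choose ⟨x, hx⟩⟩
  obtain ⟨f, hf, hfA⟩ := (isPartialTransversal_iff A I).1 hI
  obtain ⟨g, hg, hgA⟩ := (isPartialTransversal_iff A J).1 hJ
  obtain ⟨e, heJ, heI, h⟩ := partialTransversal_augment_aux A hcard g hg hgA _ f hf hfA le_rfl
  exact ⟨e, heJ, heI, (isPartialTransversal_iff A _).2 h⟩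

/-- The transversal matroid with presentation `A`, on the ground set of all elements of a finite
type `α`: its independent sets are the partial transversals of `A`. -/
def transversalMatroid {α ι : Type*} [Finite α] (A : ι → Set α) : Matroid α :=
  (IndepMatroid.ofFinite (E := Set.univ) Set.finite_univ (IsPartialTransversal A)
    ⟨fun x => x.2.elim, fun x => x.2.elim, fun x => x.2.elim⟩
    (fun _ _ ⟨φ, hφ, hA⟩ hIJ => ⟨fun x => φ ⟨x, hIJ x.2⟩,
      fun x y hxy => Subtype.ext (by simpa using hφ hxy), fun x => hA ⟨x, hIJ x.2⟩⟩)
    (fun _ _ hI hJ h => partialTransversal_augment A hI hJ h)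
    (fun I _ => Set.subset_univ I)).matroid

@[simp] theorem transversalMatroid_ground {α ι : Type*} [Finite α] (A : ι → Set α) :
    (transversalMatroid A).E = Set.univ := rfl

@[simp] theorem transversalMatroid_indep {α ι : Type*} [Finite α] (A : ι → Set α) (I : Set α) :
    (transversalMatroid A).Indep I ↔ IsPartialTransversal A I := Iff.rfl

end Transversal

/-! ### Lattice paths and lattice path matroids -/

/-- A unit step of a lattice path: north or east. -/
inductive LatticeStep
  | north
  | east
  deriving DecidableEq

/-- The set of positions of the north steps of a path with `n` steps.  Positions are counted from
`0`: the step that is usually called step `i` has position `i - 1`. -/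
def northSteps {n : ℕ} (P : Fin n → LatticeStep) : Finset (Fin n) :=
  Finset.univ.filter fun i => P i = LatticeStep.north

/-- The height reached by a path after its first `k` steps. -/
def heightAfter {n : ℕ} (P : Fin n → LatticeStep) (k : ℕ) : ℕ :=
  ((northSteps P).filter fun i : Fin n => (i : ℕ) < k).card

/-- A pair of lattice paths from `(0,0)` to `(m,r)`, the lower one (`P` in the usual notation
`M[P,Q]`) never going above the upper one (`Q`). -/
structure LatticePathPair (m r : ℕ) where
  lower : Fin (m + r) → LatticeStep
  upper : Fin (m + r) → LatticeStep
  card_lower : (northSteps lower).card = r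
  card_upper : (northSteps upper).card = r
  lower_le_upper : ∀ k ≤ m + r, heightAfter lower k ≤ heightAfter upper k

namespace LatticePathPair

variable {m r : ℕ}

/-- The path presentation: the `i`-th set is the interval `[lᵢ, uᵢ]`, where `lᵢ` and `uᵢ` are the
positions of the `i`-th north steps of the upper and of the lower path. -/
def pathPresentation (D : LatticePathPair m r) (i : Fin r) : Set (Fin (m + r)) :=
  Set.Icc ((northSteps D.upper).orderEmbOfFin D.card_upper i)
    ((northSteps D.lower).orderEmbOfFin D.card_lower i)

/-- The lattice path matroid `M[P,Q]`, on the ground set of all `m + r` positions. -/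
def matroid (D : LatticePathPair m r) : Matroid (Fin (m + r)) :=
  transversalMatroid D.pathPresentation

/-- For a connected component `X` of `M[P,Q]`, the initial connected flats of the restriction to
`X`.  The diagram of the restriction is the part of the diagram of `M[P,Q]` given by the steps in
`X`, so these sets come from the corners of the upper path at which an east step `a` in `X` is
followed by a north step `b = a + 1` in `X`, and consist of the elements of `X` up to `a`. -/
def IsInitialConnectedFlat (D : LatticePathPair m r) (X A : Set (Fin (m + r))) : Prop :=
  ∃ a ∈ X, ∃ b ∈ X, (b : ℕ) = (a : ℕ) + 1 ∧
    D.upper a = LatticeStep.east ∧ D.upper b = LatticeStep.north ∧ A = {i ∈ X | i ≤ a}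

/-- For a connected component `X` of `M[P,Q]`, the final connected flats of the restriction to
`X`: they come from the corners of the lower path at which a north step `a` in `X` is followed by
an east step `b = a + 1` in `X`, and consist of the elements of `X` from `b` on. -/
def IsFinalConnectedFlat (D : LatticePathPair m r) (X B : Set (Fin (m + r))) : Prop :=
  ∃ a ∈ X, ∃ b ∈ X, (b : ℕ) = (a : ℕ) + 1 ∧
    D.lower a = LatticeStep.north ∧ D.lower b = LatticeStep.east ∧ B = {i ∈ X | b ≤ i}

end LatticePathPair

/-! ### General matroid notions -/

namespace Matroid

/-- `X` is a connected component of `M`: a class of the relation on the ground set that relates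
`e` and `f` if `e = f` or some circuit contains both. -/
def IsConnectedComponent {α : Type*} (M : Matroid α) (X : Set α) : Prop :=
  ∃ e ∈ M.E, X = {f | f = e ∨ ∃ C, M.IsCircuit C ∧ e ∈ C ∧ f ∈ C}

/-- `(X, Y)` is a modular pair of sets of `M`. -/
def IsModularPair {α : Type*} (M : Matroid α) (X Y : Set α) : Prop :=
  M.eRk X + M.eRk Y = M.eRk (X ∪ Y) + M.eRk (X ∩ Y)

/-- A cyclic flat: a flat that is a (possibly empty) union of circuits. -/
def IsCyclicFlat {α : Type*} (M : Matroid α) (F : Set α) : Prop :=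
  M.IsFlat F ∧ ∃ 𝒞 : Set (Set α), (∀ C ∈ 𝒞, M.IsCircuit C) ∧ F = ⋃₀ 𝒞

/-- The tuple `(L, s, ρ, n)` is the configuration of `M`: there is a lattice isomorphism from `L`
onto the cyclic flats of `M`, ordered by inclusion, under which `s` and `ρ` give the sizes and the
ranks of the cyclic flats, and `n` is the size of the ground set. -/
def IsConfiguration {α : Type*} (M : Matroid α) (L : Type) [Lattice L] (s ρ : L → ℕ) (n : ℕ) :
    Prop :=
  M.E.encard = n ∧ ∃ φ : L ≃o {F : Set α // M.IsCyclicFlat F},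
    ∀ x, (φ x : Set α).encard = s x ∧ M.eRk (φ x : Set α) = ρ x

/-- Two (finite) matroids have the same configuration: some tuple `(L, s, ρ, n)` is the
configuration of both. -/
def SameConfiguration {α β : Type*} (M : Matroid α) (N : Matroid β) : Prop :=
  ∃ (L : Type) (_ : Lattice L) (s ρ : L → ℕ) (n : ℕ),
    M.IsConfiguration L s ρ n ∧ N.IsConfiguration L s ρ n

/-- `M` and `N` are isomorphic: some bijection between the ground sets preserves independence in
both directions. -/
def IsIsomorphic {α β : Type*} (M : Matroid α) (N : Matroid β) : Prop :=
  ∃ e : M.E ≃ N.E, ∀ I : Set M.E,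
    M.Indep (Subtype.val '' I) ↔ N.Indep (Subtype.val '' (e '' I))

/-- `M` is configuration unique: every finite matroid with the same configuration as `M` is
isomorphic to `M`. -/
def ConfigurationUnique.{u, v} {α : Type u} (M : Matroid α) : Prop :=
  ∀ (β : Type v) (N : Matroid β), N.Finite → M.SameConfiguration N → M.IsIsomorphic N

end Matroid

/-!
Let `N` have the same configuration as `M = M[P,Q]`. The configuration gives an isomorphism `ψ` of
the lattices of cyclic flats that preserves sizes and ranks. Since the cyclic flats and their ranks
determine a matroid (`Matroid.indep_iff_forall_isCyclicFlat`), it is enough to find a bijection of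
the ground sets that carries every cyclic flat `F` to `ψ F`.

Write `[lₖ, uₖ]` for the intervals of the path presentation, and let `Aⱼ` (`Bᵢ`) be the cyclic part,
i.e. the union of the circuits, of the flat of all elements that lie in no interval with index
`≥ j` (`< i`). These are two chains of cyclic flats. By Hall's theorem a circuit meets consecutive
intervals, say those with `i ≤ k < j`, and its closure is `Aⱼ ∩ Bᵢ`
(`exists_closure_eq_intervalFlat`). Hence every cyclic flat is a union of sets `Aⱼ ∩ Bᵢ`.

The hypothesis makes all pairs `(Aⱼ, Bᵢ)` modular, and moreover `Aⱼ ∩ Bᵢ` consists of loops or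
`Aⱼ ∪ Bᵢ` contains all circuits (`LatticePathPair.modular_cyclicPart_intervalFlat`).
This pins down the size of `ψ Aⱼ ∩ ψ Bᵢ` (`Matroid.ncard_inter_eq_of_orderIso`): its nullity is that
of the meet of `ψ Aⱼ` and `ψ Bᵢ`, so submodularity in `N` bounds its size from above by
`|Aⱼ ∩ Bᵢ|`, and the loops or the largest cyclic flat bound it from below by the same number. So all
cells cut out by the two chains have the same sizes in `M` and in `N`, and there is a bijection that
matches the two chains. It then matches the sets `Aⱼ ∩ Bᵢ` that are closures of circuits, hence all
cyclic flats (`Matroid.configurationUnique_of_two_chains`).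

For the modularity, nullity is used again: it is supermodular and does not change under passing to
the cyclic part, so modularity passes from a pair of flats to their cyclic parts
(`Matroid.modular_cyclicPart`). If `j` or `i` does not belong to a corner of its path, a smaller
flat of the same kind has the same cyclic part. If `j ≤ i`, the pair is skew. At corners with
`i < j`, either two consecutive intervals with indices from `i - 1` to `j` are disjoint and
an explicit transversal shows modularity, or all intervals with indices from `i - 1` to `j` lie in one connected component, where the hypothesis applies.
-/

/-! ### Rank and nullity in finite matroids -/

namespace Matroid

variable {α : Type*} {M : Matroid α}

/-- The rank of a set as a natural number; meaningful for matroids of finite rank only. -/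
noncomputable def natRk (M : Matroid α) (S : Set α) : ℕ := (M.eRk S).toNat

lemma coe_natRk (M : Matroid α) [M.RankFinite] (S : Set α) : (M.natRk S : ℕ∞) = M.eRk S :=
  ENat.natCast_toNat (eRk_ne_top_iff.2 (M.isRkFinite_set S))

lemma natRk_mono (M : Matroid α) [M.RankFinite] {S T : Set α} (h : S ⊆ T) :
    M.natRk S ≤ M.natRk T := by
  have := M.eRk_mono h
  rw [← coe_natRk, ← coe_natRk] at this
  exact_mod_cast this

lemma natRk_inter_add_natRk_union_le (M : Matroid α) [M.RankFinite] (S T : Set α) :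
    M.natRk (S ∩ T) + M.natRk (S ∪ T) ≤ M.natRk S + M.natRk T := by
  have := M.eRk_inter_add_eRk_union_le S T
  simp only [← coe_natRk] at this
  exact_mod_cast this

lemma Indep.natRk_eq_ncard [M.RankFinite] {I : Set α} (hI : M.Indep I) : M.natRk I = I.ncard := by
  rw [natRk, hI.eRk_eq_encard, Set.ncard_def]

/-- The nullity `|S| - r(S)` is monotone. -/
lemma natRk_add_ncard_le [M.Finite] {S T : Set α} (hST : S ⊆ T) (hT : T ⊆ M.E) :
    M.natRk T + S.ncard ≤ M.natRk S + T.ncard := by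
  have hfin : T.Finite := M.ground_finite.subset hT
  have h := M.eRk_union_le_eRk_add_encard S (T \ S)
  rw [Set.union_sdiff_cancel hST, ← coe_natRk, ← coe_natRk,
    ← Set.Finite.cast_ncard_eq (hfin.subset Set.sdiff_subset)] at h
  have h' : M.natRk T ≤ M.natRk S + (T \ S).ncard := by exact_mod_cast h
  have := Set.ncard_sdiff_add_ncard_of_subset hST hfin
  omega

lemma natRk_closure (M : Matroid α) (S : Set α) : M.natRk (M.closure S) = M.natRk S := by
  rw [natRk, eRk_closure_eq, natRk]

lemma exists_indep_ncard_eq_natRk (M : Matroid α) [M.RankFinite] (S : Set α) :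
    ∃ I ⊆ S, M.Indep I ∧ I.ncard = M.natRk S := by
  obtain ⟨I, hIS, hI, hc⟩ := (M.le_eRk_iff (n := M.eRk S) (X := S)).1 le_rfl
  exact ⟨I, hIS, hI, by rw [natRk, ← hc, Set.ncard_def]⟩

lemma IsCircuit.natRk_add_one [M.Finite] {C : Set α} (hC : M.IsCircuit C) :
    M.natRk C + 1 = C.ncard := by
  have h := hC.eRk_add_one_eq
  rw [← coe_natRk, ← Set.Finite.cast_ncard_eq (M.ground_finite.subset hC.subset_ground)] at h
  exact_mod_cast h

/-! ### Connectedness by circuits -/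

/-- Two meeting circuits put any two of their elements into a common circuit. -/
lemma IsCircuit.exists_isCircuit_of_inter_nonempty [M.Finite] {C₁ C₂ : Set α} {e g : α}
    (h₁ : M.IsCircuit C₁) (h₂ : M.IsCircuit C₂) (he : e ∈ C₁) (hg : g ∈ C₂)
    (hne : (C₁ ∩ C₂).Nonempty) : ∃ C, M.IsCircuit C ∧ e ∈ C ∧ g ∈ C := by
  -- Induction on the size of the union of the two circuits.
  obtain ⟨n, hn⟩ : ∃ n, (C₁ ∪ C₂).ncard = n := ⟨_, rfl⟩
  induction n using Nat.strong_induction_on generalizing C₁ C₂ with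
  | _ n ih =>
    have hfin : (C₁ ∪ C₂).Finite :=
      M.ground_finite.subset (Set.union_subset h₁.subset_ground h₂.subset_ground)
    by_cases heC : e ∈ C₂
    · exact ⟨C₂, h₂, heC, hg⟩
    by_cases hgC : g ∈ C₁
    · exact ⟨C₁, h₁, he, hgC⟩
    obtain ⟨f, hf₁, hf₂⟩ := hne
    obtain ⟨C₃, hC₃, h₃, he₃⟩ := h₁.strong_elimination h₂ hf₁ hf₂ he heC
    obtain ⟨C₄, hC₄, h₄, hg₄⟩ := h₂.strong_elimination h₁ hf₂ hf₁ hg hgC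
    have smaller : ∀ {D₁ D₂ : Set α}, M.IsCircuit D₁ → M.IsCircuit D₂ → e ∈ D₁ → g ∈ D₂ →
        (D₁ ∩ D₂).Nonempty → D₁ ∪ D₂ ⊂ C₁ ∪ C₂ → ∃ C, M.IsCircuit C ∧ e ∈ C ∧ g ∈ C :=
      fun hD₁ hD₂ heD hgD hne hlt => ih _ (hn ▸ Set.ncard_lt_ncard hlt hfin) hD₁ hD₂ heD hgD hne rfl
    have hf₃ : f ∉ C₃ := fun h => (hC₃ h).2 rfl
    have hf₄ : f ∉ C₄ := fun h => (hC₄ h).2 rfl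
    -- Neither new circuit lies in the one it comes from, as it misses `f`.
    have h₃₁ : ¬ C₃ ⊆ C₁ := fun h => hf₃ (h₃.eq_of_subset_isCircuit h₁ h ▸ hf₁)
    have h₄₂ : ¬ C₄ ⊆ C₂ := fun h => hf₄ (h₄.eq_of_subset_isCircuit h₂ h ▸ hf₂)
    by_cases hu : C₃ ∪ C₂ = C₁ ∪ C₂
    · obtain ⟨y, hy₄, hy₂⟩ := Set.not_subset.1 h₄₂
      have hy₁ : y ∈ C₁ := by
        rcases (hC₄ hy₄).1 with h | h
        · exact absurd h hy₂
        · exact h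
      have hy₃ : y ∈ C₃ := by
        have : y ∈ C₃ ∪ C₂ := hu ▸ Or.inl hy₁
        exact this.resolve_right hy₂
      refine smaller h₃ h₄ he₃ hg₄ ⟨y, hy₃, hy₄⟩ ?_
      refine (Set.ssubset_iff_of_subset ?_).2 ⟨f, Or.inl hf₁, fun h => h.elim hf₃ hf₄⟩
      rintro x (hx | hx)
      · exact (hC₃ hx).1
      · exact (hC₄ hx).1.symm
    · obtain ⟨y, hy₃, hy₁⟩ := Set.not_subset.1 h₃₁
      refine smaller h₃ h₂ he₃ hg ⟨y, hy₃, (hC₃ hy₃).1.resolve_left hy₁⟩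
        (lt_of_le_of_ne ?_ hu)
      rintro x (hx | hx)
      · exact (hC₃ hx).1
      · exact Or.inr hx

/-- Two elements that complete the same set to two independent sets of full rank lie in a common
circuit. -/
lemma exists_isCircuit_of_exchange [M.Finite] {I : Set α} {x y : α}
    (hx : x ∉ I) (hy : y ∉ I) (hxy : x ≠ y) (hIx : M.Indep (insert x I))
    (hIy : M.Indep (insert y I)) (hfull : M.natRk M.E ≤ I.ncard + 1) :
    ∃ C, M.IsCircuit C ∧ x ∈ C ∧ y ∈ C := by
  have hfin : I.Finite := (M.ground_finite.subset hIx.subset_ground).subset (Set.subset_insert _ _)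
  have hdep : M.Dep (insert x (insert y I)) := by
    rw [dep_iff]
    have hsub : insert x (insert y I) ⊆ M.E :=
      Set.insert_subset (hIx.subset_ground (Set.mem_insert _ _)) hIy.subset_ground
    refine ⟨fun hi => ?_, hsub⟩
    have h1 := M.natRk_mono hsub
    rw [hi.natRk_eq_ncard, Set.ncard_insert_of_notMem (by simp [hxy, hx]) (hfin.insert y),
      Set.ncard_insert_of_notMem hy hfin] at h1
    omega
  obtain ⟨C, hCs, hC⟩ := hdep.exists_isCircuit_subset
  refine ⟨C, hC, ?_, ?_⟩
  · by_contra h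
    refine hC.not_indep (hIy.subset fun z hz => ?_)
    rcases hCs hz with rfl | h'
    · exact absurd hz h
    · exact h'
  · by_contra h
    refine hC.not_indep (hIx.subset fun z hz => ?_)
    rcases hCs hz with rfl | rfl | h'
    · exact Or.inl rfl
    · exact absurd hz h
    · exact Or.inr h'

/-! ### Cyclic parts and cyclic flats -/

/-- The union of the circuits contained in `S`. -/
def cyclicPart (M : Matroid α) (S : Set α) : Set α := ⋃₀ {C | M.IsCircuit C ∧ C ⊆ S}

lemma cyclicPart_subset (M : Matroid α) (S : Set α) : M.cyclicPart S ⊆ S :=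
  Set.sUnion_subset fun _ h => h.2

lemma IsCircuit.subset_cyclicPart {C S : Set α} (hC : M.IsCircuit C) (h : C ⊆ S) :
    C ⊆ M.cyclicPart S :=
  Set.subset_sUnion_of_mem ⟨hC, h⟩

lemma cyclicPart_mono (M : Matroid α) {S T : Set α} (h : S ⊆ T) :
    M.cyclicPart S ⊆ M.cyclicPart T :=
  Set.sUnion_subset_sUnion fun _ hC => ⟨hC.1, hC.2.trans h⟩

lemma cyclicPart_subset_cyclicPart_iff {S T : Set α} :
    M.cyclicPart S ⊆ M.cyclicPart T ↔ ∀ C, M.IsCircuit C → C ⊆ S → C ⊆ T :=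
  ⟨fun h _ hC hCS => (hC.subset_cyclicPart hCS).trans (h.trans (M.cyclicPart_subset T)),
    fun h => Set.sUnion_subset fun C hC => hC.1.subset_cyclicPart (h C hC.1 hC.2)⟩

lemma IsCyclicFlat.subset_ground {F : Set α} (hF : M.IsCyclicFlat F) : F ⊆ M.E :=
  hF.1.subset_ground

lemma IsCyclicFlat.exists_isCircuit {F : Set α} (hF : M.IsCyclicFlat F) {x : α} (hx : x ∈ F) :
    ∃ C, M.IsCircuit C ∧ x ∈ C ∧ C ⊆ F := by
  obtain ⟨-, 𝒞, h𝒞, rfl⟩ := hF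
  obtain ⟨C, hC, hxC⟩ := hx
  exact ⟨C, h𝒞 C hC, hxC, Set.subset_sUnion_of_mem hC⟩

lemma isCyclicFlat_of_forall_exists {F : Set α} (hF : M.IsFlat F)
    (h : ∀ x ∈ F, ∃ C, M.IsCircuit C ∧ x ∈ C ∧ C ⊆ F) : M.IsCyclicFlat F := by
  refine ⟨hF, {C | M.IsCircuit C ∧ C ⊆ F}, fun C hC => hC.1, ?_⟩
  refine (Set.Subset.antisymm (M.cyclicPart_subset F) fun x hx => ?_).symm
  obtain ⟨C, hC, hxC, hCF⟩ := h x hx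
  exact ⟨C, ⟨hC, hCF⟩, hxC⟩

lemma IsFlat.isCyclicFlat_cyclicPart {F : Set α} (hF : M.IsFlat F) :
    M.IsCyclicFlat (M.cyclicPart F) := by
  refine isCyclicFlat_of_forall_exists ?_ fun x ⟨C, hC, hx⟩ =>
    ⟨C, hC.1, hx, hC.1.subset_cyclicPart hC.2⟩
  have hsub := M.cyclicPart_subset F
  have hE := hsub.trans hF.subset_ground
  rw [isFlat_iff_closure_eq]
  refine Set.Subset.antisymm (fun x hx => ?_) (M.subset_closure _ hE)
  by_contra hxF
  obtain ⟨C, hC, hCc, hxC⟩ := exists_isCircuit_of_mem_closure hx hxF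
  have hxF' : x ∈ F := by
    rw [← hF.closure]
    exact M.closure_subset_closure hsub hx
  exact hxF (hCc.subset_cyclicPart (hC.trans (Set.insert_subset hxF' hsub)) hxC)

/-- The closure of a union of circuits is a cyclic flat. -/
lemma isCyclicFlat_closure {S : Set α} (hS : ∀ x ∈ S, ∃ C, M.IsCircuit C ∧ x ∈ C ∧ C ⊆ S) :
    M.IsCyclicFlat (M.closure S) := by
  have hSE : S ⊆ M.E := fun x hx => by
    obtain ⟨C, hC, hxC, -⟩ := hS x hx
    exact hC.subset_ground hxC
  refine isCyclicFlat_of_forall_exists (M.isFlat_closure S) fun x hx => ?_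
  by_cases hxS : x ∈ S
  · obtain ⟨C, hC, hxC, hCS⟩ := hS x hxS
    exact ⟨C, hC, hxC, hCS.trans (M.subset_closure S hSE)⟩
  · obtain ⟨C, hC, hCc, hxC⟩ := exists_isCircuit_of_mem_closure hx hxS
    exact ⟨C, hCc, hxC, hC.trans (Set.insert_subset hx (M.subset_closure S hSE))⟩

lemma IsCircuit.isCyclicFlat_closure {C : Set α} (hC : M.IsCircuit C) :
    M.IsCyclicFlat (M.closure C) :=
  Matroid.isCyclicFlat_closure fun _ hx => ⟨C, hC, hx, subset_rfl⟩

/-- Passing to the cyclic part does not change the nullity `|S| - r(S)`. -/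
lemma natRk_add_ncard_cyclicPart [M.Finite] {S : Set α} (hS : S ⊆ M.E) :
    M.natRk S + (M.cyclicPart S).ncard = M.natRk (M.cyclicPart S) + S.ncard := by
  have hsub := M.cyclicPart_subset S
  have hfin : S.Finite := M.ground_finite.subset hS
  obtain ⟨I, hI⟩ := M.exists_isBasis (M.cyclicPart S) (hsub.trans hS)
  have hJ : M.Indep (I ∪ (S \ M.cyclicPart S)) := by
    rw [indep_iff_forall_subset_not_isCircuit
      (Set.union_subset hI.indep.subset_ground (Set.sdiff_subset.trans hS))]
    intro C hC hCc
    have hCS : C ⊆ M.cyclicPart S := hCc.subset_cyclicPart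
      (hC.trans (Set.union_subset (hI.subset.trans hsub) Set.sdiff_subset))
    exact hCc.not_indep (hI.indep.subset fun x hx =>
      (hC hx).resolve_right fun h => h.2 (hCS hx))
  have hJb : M.IsBasis (I ∪ (S \ M.cyclicPart S)) S := by
    refine hJ.isBasis_of_subset_of_subset_closure
      (Set.union_subset (hI.subset.trans hsub) Set.sdiff_subset) fun x hx => ?_
    by_cases hxc : x ∈ M.cyclicPart S
    · exact M.closure_subset_closure Set.subset_union_left (hI.subset_closure hxc)
    · exact M.subset_closure _ hJ.subset_ground (Or.inr ⟨hx, hxc⟩)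
  have h1 : M.natRk S = I.ncard + (S \ M.cyclicPart S).ncard := by
    rw [natRk, hJb.eRk_eq_encard, ← Set.ncard_def, Set.ncard_union_eq
      (Set.disjoint_left.2 fun x hx hx' => hx'.2 (hI.subset hx))
      (hfin.subset (hI.subset.trans hsub)) (hfin.subset Set.sdiff_subset)]
  have h2 : M.natRk (M.cyclicPart S) = I.ncard := by
    rw [natRk, hI.eRk_eq_encard, ← Set.ncard_def]
  have h3 := Set.ncard_sdiff_add_ncard_of_subset hsub hfin
  omega

/-- The cyclic flats and their ranks determine the independent sets. -/
lemma indep_iff_forall_isCyclicFlat [M.Finite] {I : Set α} (hI : I ⊆ M.E) :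
    M.Indep I ↔ ∀ F, M.IsCyclicFlat F → (I ∩ F).ncard ≤ M.natRk F := by
  refine ⟨fun h F _ => ?_, fun h => ?_⟩
  · rw [← (h.subset Set.inter_subset_left : M.Indep (I ∩ F)).natRk_eq_ncard]
    exact M.natRk_mono Set.inter_subset_right
  · rw [indep_iff_forall_subset_not_isCircuit hI]
    intro C hCI hC
    have h1 := h _ hC.isCyclicFlat_closure
    have h2 : C.ncard ≤ (I ∩ M.closure C).ncard :=
      Set.ncard_le_ncard (Set.subset_inter hCI (M.subset_closure C hC.subset_ground))
        ((M.ground_finite.subset hI).subset Set.inter_subset_left)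
    rw [natRk_closure] at h1
    have := hC.natRk_add_one
    omega

/-- Modularity of a pair of sets passes to their cyclic parts, and the union of the cyclic parts
then contains every circuit of the union. This holds because nullity is supermodular, monotone and
unchanged by passing to cyclic parts. -/
lemma modular_cyclicPart [M.Finite] {A B : Set α} (hA : A ⊆ M.E) (hB : B ⊆ M.E)
    (h : M.natRk A + M.natRk B ≤ M.natRk (A ∪ B) + M.natRk (A ∩ B)) :
    M.natRk (M.cyclicPart A) + M.natRk (M.cyclicPart B) ≤
      M.natRk (M.cyclicPart A ∪ M.cyclicPart B) + M.natRk (M.cyclicPart A ∩ M.cyclicPart B) ∧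
    M.cyclicPart (A ∪ B) ⊆ M.cyclicPart A ∪ M.cyclicPart B := by
  set a := M.cyclicPart A with ha
  set b := M.cyclicPart B with hb
  have haA : a ⊆ A := M.cyclicPart_subset A
  have hbB : b ⊆ B := M.cyclicPart_subset B
  have hU : A ∪ B ⊆ M.E := Set.union_subset hA hB
  have hUfin : (A ∪ B).Finite := M.ground_finite.subset hU
  have hAfin : A.Finite := M.ground_finite.subset hA
  have hBfin : B.Finite := M.ground_finite.subset hB
  have huU : a ∪ b ⊆ A ∪ B := Set.union_subset_union haA hbB
  have hcyc : M.cyclicPart (a ∩ b) = M.cyclicPart (A ∩ B) :=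
    Set.Subset.antisymm (M.cyclicPart_mono (Set.inter_subset_inter haA hbB))
      (cyclicPart_subset_cyclicPart_iff.2 fun C hC hCS => Set.subset_inter
        (hC.subset_cyclicPart (hCS.trans Set.inter_subset_left))
        (hC.subset_cyclicPart (hCS.trans Set.inter_subset_right)))
  have e1 := natRk_add_ncard_cyclicPart hA
  have e2 := natRk_add_ncard_cyclicPart hB
  rw [← ha] at e1
  rw [← hb] at e2
  have e3 := natRk_add_ncard_cyclicPart (M := M) (S := A ∩ B) (Set.inter_subset_left.trans hA)
  have e4 := natRk_add_ncard_cyclicPart (M := M) (S := a ∩ b)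
    (Set.inter_subset_left.trans (haA.trans hA))
  rw [hcyc] at e4
  have e5 := natRk_add_ncard_le huU hU
  have e6 := Set.ncard_union_add_ncard_inter A B hAfin hBfin
  have e7 := Set.ncard_union_add_ncard_inter a b (hAfin.subset haA) (hBfin.subset hbB)
  have e8 := M.natRk_inter_add_natRk_union_le a b
  refine ⟨by omega, ?_⟩
  rintro x ⟨C, ⟨hC, hCU⟩, hxC⟩
  by_contra hx
  -- Deleting `x` from the union keeps the rank, so the nullity would drop.
  have e9 : M.natRk (A ∪ B) ≤ M.natRk ((A ∪ B) \ {x}) := by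
    rw [← M.natRk_closure ((A ∪ B) \ {x})]
    refine M.natRk_mono fun y hy => ?_
    by_cases hyx : y = x
    · subst hyx
      exact M.closure_subset_closure (Set.sdiff_subset_sdiff_left hCU)
        (hC.mem_closure_sdiff_singleton_of_mem hxC)
    · exact M.subset_closure _ (Set.sdiff_subset.trans hU) ⟨hy, hyx⟩
  have e10 := natRk_add_ncard_le (M := M) (S := a ∪ b) (T := (A ∪ B) \ {x})
    (Set.subset_sdiff_singleton huU hx) (Set.sdiff_subset.trans hU)
  have e11 := Set.ncard_sdiff_singleton_add_one (hCU hxC) hUfin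
  omega

end Matroid

/-! ### Bijections that match two chains of sets -/

lemma ncard_le_succ {X : Type*} [Finite X] (f : X → ℕ) (p : X → Prop) (i : ℕ) :
    {x | f x ≤ i + 1 ∧ p x}.ncard = {x | f x ≤ i ∧ p x}.ncard + {x | f x = i + 1 ∧ p x}.ncard := by
  rw [← Set.ncard_union_eq (Set.disjoint_left.2 fun x hx hx' => by
    have h1 := hx.1
    have h2 := hx'.1
    omega)]
  congr 1
  ext x
  simp only [Set.mem_ofPred_eq, Set.mem_union, ← or_and_right]
  exact and_congr_left fun _ => by omega

lemma ncard_fiber_eq_of_ncard_le_eq {X Y : Type*} [Finite X] [Finite Y] {f : X → ℕ} {f' : Y → ℕ}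
    {p : X → Prop} {p' : Y → Prop}
    (h : ∀ i, {x | f x ≤ i ∧ p x}.ncard = {y | f' y ≤ i ∧ p' y}.ncard) (i : ℕ) :
    {x | f x = i ∧ p x}.ncard = {y | f' y = i ∧ p' y}.ncard := by
  rcases i with _ | i
  · simpa using h 0
  · have h1 := h i
    have h2 := h (i + 1)
    rw [ncard_le_succ, ncard_le_succ] at h2
    omega

/-- Two pairs of rank functions with the same joint cumulative counts are matched by a
bijection. -/
lemma exists_equiv_of_ncard_le_eq {X Y : Type*} [Finite X] [Finite Y] {f g : X → ℕ}
    {f' g' : Y → ℕ}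
    (h : ∀ i j, {x | f x ≤ i ∧ g x ≤ j}.ncard = {y | f' y ≤ i ∧ g' y ≤ j}.ncard) :
    ∃ e : X ≃ Y, ∀ x, f' (e x) = f x ∧ g' (e x) = g x := by
  have h1 : ∀ i j, {x | g x ≤ j ∧ f x = i}.ncard = {y | g' y ≤ j ∧ f' y = i}.ncard := by
    intro i j
    simpa only [and_comm] using ncard_fiber_eq_of_ncard_le_eq (fun i => h i j) i
  have h2 : ∀ c : ℕ × ℕ, Nonempty ({x // (f x, g x) = c} ≃ {y // (f' y, g' y) = c}) := by
    rintro ⟨i, j⟩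
    have h3 := ncard_fiber_eq_of_ncard_le_eq (h1 i) j
    have e1 : {x | g x = j ∧ f x = i} = {x | (f x, g x) = (i, j)} := by
      ext x
      simp [and_comm]
    have e2 : {y | g' y = j ∧ f' y = i} = {y | (f' y, g' y) = (i, j)} := by
      ext y
      simp [and_comm]
    rw [e1, e2] at h3
    exact Finite.card_eq.1 h3
  refine ⟨Equiv.ofFiberEquiv fun c => (h2 c).some, fun x => ?_⟩
  have := Equiv.ofFiberEquiv_map (fun c => (h2 c).some) x
  simpa using this

open Classical in
/-- The position of `x` in the increasing sequence `A 0 ⊆ ⋯ ⊆ A R`: the number of its terms that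
do not contain `x`. -/
noncomputable def chainPosition {α : Type*} (A : ℕ → Set α) (R : ℕ) (x : α) : ℕ :=
  ((Finset.range (R + 1)).filter fun k => x ∉ A k).card

lemma chainPosition_le {α : Type*} (A : ℕ → Set α) (R : ℕ) (x : α) :
    chainPosition A R x ≤ R + 1 := by
  classical
  exact (Finset.card_filter_le _ _).trans (Finset.card_range _).le

lemma chainPosition_le_iff {α : Type*} {A : ℕ → Set α} (hA : Monotone A) {R j : ℕ} (hj : j ≤ R)
    (x : α) : chainPosition A R x ≤ j ↔ x ∈ A j := by
  classical
  constructor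
  · intro h
    by_contra hx
    have hsub : Finset.range (j + 1) ⊆ (Finset.range (R + 1)).filter fun k => x ∉ A k := by
      intro k hk
      rw [Finset.mem_range] at hk
      exact Finset.mem_filter.2 ⟨Finset.mem_range.2 (by omega), fun h' => hx (hA (by omega) h')⟩
    have h1 := Finset.card_le_card hsub
    rw [Finset.card_range] at h1
    unfold chainPosition at h
    omega
  · intro hx
    have hsub : ((Finset.range (R + 1)).filter fun k => x ∉ A k) ⊆ Finset.range j := by
      intro k hk
      rw [Finset.mem_filter] at hk
      by_contra hkj
      rw [Finset.mem_range, not_lt] at hkj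
      exact hk.2 (hA hkj hx)
    simpa [chainPosition] using Finset.card_le_card hsub

/-! ### Configuration uniqueness from two chains of cyclic flats -/

namespace Matroid

variable {α β : Type*} {M : Matroid α} {N : Matroid β}

lemma IsFlat.inter {F G : Set α} (hF : M.IsFlat F) (hG : M.IsFlat G) : M.IsFlat (F ∩ G) := by
  rw [isFlat_iff_closure_eq]
  refine Set.Subset.antisymm (Set.subset_inter ?_ ?_)
    (M.subset_closure _ (Set.inter_subset_left.trans hF.subset_ground))
  · exact (M.closure_subset_closure Set.inter_subset_left).trans hF.closure.subset
  · exact (M.closure_subset_closure Set.inter_subset_right).trans hG.closure.subset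

lemma IsCyclicFlat.subset_cyclicPart {F S : Set α} (hF : M.IsCyclicFlat F) (h : F ⊆ S) :
    F ⊆ M.cyclicPart S := fun x hx => by
  obtain ⟨C, hC, hxC, hCF⟩ := hF.exists_isCircuit hx
  exact hC.subset_cyclicPart (hCF.trans h) hxC

/-- For a modular pair of cyclic flats that meet in a cyclic flat or together contain all circuits,
the size of the intersection is determined by the lattice of cyclic flats with the sizes and ranks
of its members. The upper bound comes from submodularity, since the nullity of the intersection is
that of the meet in the lattice; the lower bound comes from the meet or from the largest cyclic
flat. -/
lemma ncard_inter_eq_of_orderIso [M.Finite] [N.Finite]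
    (ψ : {F : Set α // M.IsCyclicFlat F} ≃o {F : Set β // N.IsCyclicFlat F})
    (hcard : ∀ F, (ψ F).1.ncard = F.1.ncard) (hrk : ∀ F, N.natRk (ψ F).1 = M.natRk F.1)
    (A B : {F : Set α // M.IsCyclicFlat F})
    (hmod : M.natRk A.1 + M.natRk B.1 ≤ M.natRk (A.1 ∪ B.1) + M.natRk (A.1 ∩ B.1))
    (hcov : A.1 ∩ B.1 ⊆ M.cyclicPart (A.1 ∩ B.1) ∨ M.cyclicPart M.E ⊆ A.1 ∪ B.1) :
    ((ψ A).1 ∩ (ψ B).1).ncard = (A.1 ∩ B.1).ncard := by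
  have hAE := A.2.subset_ground
  have hBE := B.2.subset_ground
  have hAE' := (ψ A).2.subset_ground
  have hBE' := (ψ B).2.subset_ground
  have hAf := M.ground_finite.subset hAE
  have hBf := M.ground_finite.subset hBE
  have hAf' := N.ground_finite.subset hAE'
  have hBf' := N.ground_finite.subset hBE'
  let K : {F : Set α // M.IsCyclicFlat F} :=
    ⟨M.cyclicPart (A.1 ∩ B.1), (A.2.1.inter B.2.1).isCyclicFlat_cyclicPart⟩
  let K' : {F : Set β // N.IsCyclicFlat F} :=
    ⟨N.cyclicPart ((ψ A).1 ∩ (ψ B).1), ((ψ A).2.1.inter (ψ B).2.1).isCyclicFlat_cyclicPart⟩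
  have hKA : K ≤ A := (M.cyclicPart_subset _).trans Set.inter_subset_left
  have hKB : K ≤ B := (M.cyclicPart_subset _).trans Set.inter_subset_right
  have hKA' : K' ≤ ψ A := (N.cyclicPart_subset _).trans Set.inter_subset_left
  have hKB' : K' ≤ ψ B := (N.cyclicPart_subset _).trans Set.inter_subset_right
  have hψK : ψ K = K' := by
    apply le_antisymm
    · exact (ψ K).2.subset_cyclicPart
        (Set.subset_inter (ψ.monotone hKA) (ψ.monotone hKB))
    · rw [← ψ.symm_apply_le]
      refine (ψ.symm K').2.subset_cyclicPart (Set.subset_inter ?_ ?_)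
      · exact ψ.symm_apply_le.2 hKA'
      · exact ψ.symm_apply_le.2 hKB'
  have hjoin : M.natRk (A.1 ∪ B.1) ≤ N.natRk ((ψ A).1 ∪ (ψ B).1) := by
    have hcl : N.IsCyclicFlat (N.closure ((ψ A).1 ∪ (ψ B).1)) := by
      refine isCyclicFlat_closure ?_
      rintro x (hx | hx)
      · obtain ⟨C, hC, hxC, hCF⟩ := (ψ A).2.exists_isCircuit hx
        exact ⟨C, hC, hxC, hCF.trans Set.subset_union_left⟩
      · obtain ⟨C, hC, hxC, hCF⟩ := (ψ B).2.exists_isCircuit hx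
        exact ⟨C, hC, hxC, hCF.trans Set.subset_union_right⟩
    have hsub := N.subset_closure _ (Set.union_subset hAE' hBE')
    have h1 : A ≤ ψ.symm ⟨_, hcl⟩ := ψ.le_symm_apply.2 (Set.subset_union_left.trans hsub)
    have h2 : B ≤ ψ.symm ⟨_, hcl⟩ := ψ.le_symm_apply.2 (Set.subset_union_right.trans hsub)
    have h3 := hrk (ψ.symm ⟨_, hcl⟩)
    rw [ψ.apply_symm_apply, natRk_closure] at h3
    rw [h3]
    exact M.natRk_mono (Set.union_subset h1 h2)
  have e1 := natRk_add_ncard_cyclicPart (M := M) (S := A.1 ∩ B.1)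
    (Set.inter_subset_left.trans hAE)
  have e2 := natRk_add_ncard_cyclicPart (M := N) (S := (ψ A).1 ∩ (ψ B).1)
    (Set.inter_subset_left.trans hAE')
  have e3 := N.natRk_inter_add_natRk_union_le (ψ A).1 (ψ B).1
  have c1 : (N.cyclicPart ((ψ A).1 ∩ (ψ B).1)).ncard = (M.cyclicPart (A.1 ∩ B.1)).ncard := by
    have := hcard K
    rwa [hψK] at this
  have c2 : N.natRk (N.cyclicPart ((ψ A).1 ∩ (ψ B).1)) = M.natRk (M.cyclicPart (A.1 ∩ B.1)) := by
    have := hrk K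
    rwa [hψK] at this
  rw [hrk A, hrk B] at e3
  apply le_antisymm
  · omega
  · rcases hcov with hcov | hcov
    · have h1 := Set.ncard_le_ncard hcov
        ((hAf.inter_of_left B.1).subset (M.cyclicPart_subset _))
      have h2 := Set.ncard_le_ncard (N.cyclicPart_subset ((ψ A).1 ∩ (ψ B).1))
        (hAf'.inter_of_left _)
      omega
    · let T : {F : Set α // M.IsCyclicFlat F} :=
        ⟨M.cyclicPart M.E, M.ground_isFlat.isCyclicFlat_cyclicPart⟩
      have hTA : A ≤ T := A.2.subset_cyclicPart hAE
      have hTB : B ≤ T := B.2.subset_cyclicPart hBE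
      have h1 := Set.ncard_le_ncard (Set.union_subset (ψ.monotone hTA) (ψ.monotone hTB))
        (N.ground_finite.subset (ψ T).2.subset_ground)
      have h2 : (M.cyclicPart M.E).ncard ≤ (A.1 ∪ B.1).ncard :=
        Set.ncard_le_ncard hcov (hAf.union hBf)
      have h3 : (ψ T).1.ncard = (M.cyclicPart M.E).ncard := hcard T
      have h4 := Set.ncard_union_add_ncard_inter _ _ hAf hBf
      have h5 := Set.ncard_union_add_ncard_inter _ _ hAf' hBf'
      have h6 := hcard A
      have h7 := hcard B
      omega

/-- A bijection that carries every cyclic flat to its image under a rank-preserving isomorphism of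
the lattices of cyclic flats is an isomorphism of matroids. -/
lemma isIsomorphic_of_orderIso [M.Finite] [N.Finite]
    (ψ : {F : Set α // M.IsCyclicFlat F} ≃o {F : Set β // N.IsCyclicFlat F})
    (hrk : ∀ F, N.natRk (ψ F).1 = M.natRk F.1) (e : M.E ≃ N.E)
    (he : ∀ F, ∀ x : M.E, (e x : β) ∈ (ψ F).1 ↔ (x : α) ∈ F.1) : M.IsIsomorphic N := by
  refine ⟨e, fun I => ?_⟩
  have hsub : (Subtype.val '' I : Set α) ⊆ M.E := by
    rintro _ ⟨x, -, rfl⟩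
    exact x.2
  have hsub' : (Subtype.val '' (e '' I) : Set β) ⊆ N.E := by
    rintro _ ⟨x, -, rfl⟩
    exact x.2
  have hinj : Function.Injective fun x : M.E => (e x : β) :=
    Subtype.val_injective.comp e.injective
  have key : ∀ F, (Subtype.val '' (e '' I) ∩ (ψ F).1).ncard = (Subtype.val '' I ∩ F.1).ncard := by
    intro F
    have h1 : Subtype.val '' (e '' I) ∩ (ψ F).1
        = (fun x : M.E => (e x : β)) '' (I ∩ {x | (x : α) ∈ F.1}) := by
      ext y
      constructor
      · rintro ⟨⟨_, ⟨x, hx, rfl⟩, rfl⟩, hy⟩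
        exact ⟨x, ⟨hx, (he F x).1 hy⟩, rfl⟩
      · rintro ⟨x, ⟨hx, hxF⟩, rfl⟩
        exact ⟨⟨_, ⟨x, hx, rfl⟩, rfl⟩, (he F x).2 hxF⟩
    have h2 : Subtype.val '' I ∩ F.1 = Subtype.val '' (I ∩ {x : M.E | (x : α) ∈ F.1}) := by
      ext y
      constructor
      · rintro ⟨⟨x, hx, rfl⟩, hy⟩
        exact ⟨x, ⟨hx, hy⟩, rfl⟩
      · rintro ⟨x, ⟨hx, hxF⟩, rfl⟩
        exact ⟨⟨x, hx, rfl⟩, hxF⟩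
    rw [h1, h2, Set.ncard_image_of_injective _ hinj,
      Set.ncard_image_of_injective _ Subtype.val_injective]
  rw [indep_iff_forall_isCyclicFlat hsub, indep_iff_forall_isCyclicFlat hsub']
  constructor
  · intro h F' hF'
    have h1 := h _ (ψ.symm ⟨F', hF'⟩).2
    have h2 := key (ψ.symm ⟨F', hF'⟩)
    have h3 := hrk (ψ.symm ⟨F', hF'⟩)
    rw [ψ.apply_symm_apply] at h2 h3
    simp only at h2 h3
    omega
  · intro h F hF
    have h1 := h _ (ψ ⟨F, hF⟩).2
    have h2 := key ⟨F, hF⟩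
    have h3 := hrk ⟨F, hF⟩
    simp only at h2 h3
    omega

lemma ncard_setOf_val_mem {E S : Set α} (hS : S ⊆ E) : {x : E | (x : α) ∈ S}.ncard = S.ncard := by
  rw [← Set.ncard_image_of_injective _ Subtype.val_injective]
  congr 1
  ext y
  constructor
  · rintro ⟨x, hx, rfl⟩
    exact hx
  · exact fun hy => ⟨⟨y, hS hy⟩, hy, rfl⟩

/-- Past the last index of the chain the level sets of the position are the whole ground set. -/
lemma chainPosition_le_iff_mem_ite {R : ℕ} (S : ℕ → {F : Set α // M.IsCyclicFlat F})
    (hS : Monotone fun i => (S i).1) (i : ℕ) (x : M.E) :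
    chainPosition (fun i => (S i).1) R x ≤ i ↔ (x : α) ∈ if i ≤ R then (S i).1 else M.E := by
  split_ifs with hi
  · exact chainPosition_le_iff hS hi x
  · exact ⟨fun _ => x.2, fun _ => (chainPosition_le _ _ _).trans (by omega)⟩

/-- A finite matroid is configuration unique if it has two chains of cyclic flats such that every
closure of a circuit is an intersection of a member of the first and a member of the second, and
such that any two such members form a modular pair that meets in a cyclic flat or contains all
circuits. -/
theorem configurationUnique_of_two_chains [M.Finite] (R : ℕ)
    (A B : ℕ → {F : Set α // M.IsCyclicFlat F}) (hA : Monotone A) (hB : Monotone B)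
    (hmod : ∀ i ≤ R, ∀ j ≤ R, M.natRk (A i).1 + M.natRk (B j).1 ≤
      M.natRk ((A i).1 ∪ (B j).1) + M.natRk ((A i).1 ∩ (B j).1))
    (hcov : ∀ i ≤ R, ∀ j ≤ R, (A i).1 ∩ (B j).1 ⊆ M.cyclicPart ((A i).1 ∩ (B j).1) ∨
      M.cyclicPart M.E ⊆ (A i).1 ∪ (B j).1)
    (hgen : ∀ C, M.IsCircuit C → ∃ i ≤ R, ∃ j ≤ R, M.closure C = (A i).1 ∩ (B j).1) :
    M.ConfigurationUnique := by
  intro β N hN hMN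
  obtain ⟨L, _, s, ρ, n, ⟨hME, φ, hφ⟩, ⟨hNE, φ', hφ'⟩⟩ := hMN
  let ψ : {F : Set α // M.IsCyclicFlat F} ≃o {F : Set β // N.IsCyclicFlat F} := φ.symm.trans φ'
  have hcard : ∀ F, (ψ F).1.ncard = F.1.ncard := by
    intro F
    have h1 := (hφ (φ.symm F)).1
    have h2 := (hφ' (φ.symm F)).1
    rw [φ.apply_symm_apply] at h1
    rw [Set.ncard_def, Set.ncard_def, h1, ← h2]
    rfl
  have hrk : ∀ F, N.natRk (ψ F).1 = M.natRk F.1 := by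
    intro F
    have h1 := (hφ (φ.symm F)).2
    have h2 := (hφ' (φ.symm F)).2
    rw [φ.apply_symm_apply] at h1
    rw [natRk, natRk, h1, ← h2]
    rfl
  have hE : M.E.ncard = N.E.ncard := by rw [Set.ncard_def, Set.ncard_def, hME, hNE]
  have hinter : ∀ i ≤ R, ∀ j ≤ R,
      ((ψ (A i)).1 ∩ (ψ (B j)).1).ncard = ((A i).1 ∩ (B j).1).ncard := fun i hi j hj =>
    ncard_inter_eq_of_orderIso ψ hcard hrk _ _ (hmod i hi j hj) (hcov i hi j hj)
  have : Finite M.E := M.ground_finite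
  have : Finite N.E := N.ground_finite
  have hA1 : Monotone fun i => (A i).1 := hA
  have hB1 : Monotone fun i => (B i).1 := hB
  have hA2 : Monotone fun i => (ψ (A i)).1 := ψ.monotone.comp hA
  have hB2 : Monotone fun i => (ψ (B i)).1 := ψ.monotone.comp hB
  obtain ⟨e, he⟩ := exists_equiv_of_ncard_le_eq
    (f := fun x : M.E => chainPosition (fun i => (A i).1) R x)
    (g := fun x : M.E => chainPosition (fun i => (B i).1) R x)
    (f' := fun y : N.E => chainPosition (fun i => (ψ (A i)).1) R y)
    (g' := fun y : N.E => chainPosition (fun i => (ψ (B i)).1) R y) (by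
      intro i j
      simp only [chainPosition_le_iff_mem_ite A hA1, chainPosition_le_iff_mem_ite B hB1,
        chainPosition_le_iff_mem_ite (fun i => ψ (A i)) hA2,
        chainPosition_le_iff_mem_ite (fun i => ψ (B i)) hB2, ← Set.mem_inter_iff]
      rw [ncard_setOf_val_mem, ncard_setOf_val_mem]
      · split_ifs with hi hj hj
        · exact (hinter i hi j hj).symm
        · rw [Set.inter_eq_left.2 (A i).2.subset_ground,
            Set.inter_eq_left.2 (ψ (A i)).2.subset_ground, hcard]
        · rw [Set.inter_eq_right.2 (B j).2.subset_ground,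
            Set.inter_eq_right.2 (ψ (B j)).2.subset_ground, hcard]
        · simpa using hE
      · split_ifs
        · exact Set.inter_subset_left.trans (ψ (A i)).2.subset_ground
        · exact Set.inter_subset_left.trans (ψ (A i)).2.subset_ground
        · exact Set.inter_subset_left
        · exact Set.inter_subset_left
      · split_ifs
        · exact Set.inter_subset_left.trans (A i).2.subset_ground
        · exact Set.inter_subset_left.trans (A i).2.subset_ground
        · exact Set.inter_subset_left
        · exact Set.inter_subset_left)
  have heA : ∀ i ≤ R, ∀ x : M.E, (e x : β) ∈ (ψ (A i)).1 ↔ (x : α) ∈ (A i).1 := by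
    intro i hi x
    rw [← chainPosition_le_iff hA1 hi, ← chainPosition_le_iff hA2 hi]
    exact iff_of_eq (congrArg (· ≤ i) (he x).1)
  have heB : ∀ i ≤ R, ∀ x : M.E, (e x : β) ∈ (ψ (B i)).1 ↔ (x : α) ∈ (B i).1 := by
    intro i hi x
    rw [← chainPosition_le_iff hB1 hi, ← chainPosition_le_iff hB2 hi]
    exact iff_of_eq (congrArg (· ≤ i) (he x).2)
  -- A one-sided containment suffices, since `F` and its image have the same size.
  have upgrade : ∀ F : {F : Set α // M.IsCyclicFlat F},
      ((∀ x : M.E, (e x : β) ∈ (ψ F).1 → (x : α) ∈ F.1) ∨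
        ∀ x : M.E, (x : α) ∈ F.1 → (e x : β) ∈ (ψ F).1) →
      ∀ x : M.E, (e x : β) ∈ (ψ F).1 ↔ (x : α) ∈ F.1 := by
    intro F h
    have h1 : {x : M.E | (e x : β) ∈ (ψ F).1}.ncard = F.1.ncard := by
      rw [← hcard F, ← ncard_setOf_val_mem (ψ F).2.subset_ground,
        ← Set.ncard_image_of_injective _ e.injective]
      congr 1
      ext y
      constructor
      · rintro ⟨x, hx, rfl⟩
        exact hx
      · exact fun hy => ⟨e.symm y, by simpa using hy, by simp⟩
    have h2 : {x : M.E | (x : α) ∈ F.1}.ncard = F.1.ncard :=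
      ncard_setOf_val_mem F.2.subset_ground
    have h3 : {x : M.E | (e x : β) ∈ (ψ F).1} = {x : M.E | (x : α) ∈ F.1} := by
      rcases h with h | h
      · exact Set.eq_of_subset_of_ncard_le h (h2.trans h1.symm).le (Set.toFinite _)
      · exact (Set.eq_of_subset_of_ncard_le h (h1.trans h2.symm).le (Set.toFinite _)).symm
    exact fun x => iff_of_eq (congrArg (x ∈ ·) h3)
  refine isIsomorphic_of_orderIso ψ hrk e fun F => upgrade F (Or.inr fun x hx => ?_)
  obtain ⟨C, hC, hxC, hCF⟩ := F.2.exists_isCircuit hx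
  obtain ⟨i, hi, j, hj, hcl⟩ := hgen C hC
  let G : {F : Set α // M.IsCyclicFlat F} := ⟨M.closure C, hC.isCyclicFlat_closure⟩
  have hGA : G ≤ A i := hcl.subset.trans Set.inter_subset_left
  have hGB : G ≤ B j := hcl.subset.trans Set.inter_subset_right
  have hGF : G ≤ F := by
    refine (M.closure_subset_closure hCF).trans ?_
    rw [F.2.1.closure]
  refine ψ.monotone hGF ((upgrade G (Or.inl fun y hy => ?_) x).2
    (M.subset_closure C hC.subset_ground hxC))
  exact hcl.superset ⟨(heA i hi y).1 (ψ.monotone hGA hy), (heB j hj y).1 (ψ.monotone hGB hy)⟩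

end Matroid

/-! ### Ranks, flats and circuits of transversal matroids -/

section Transversal

open Matroid

variable {α ι : Type*} [Finite α] {A : ι → Set α}

/-- The elements that lie in no member of the set system outside the index set `K`. -/
def confinedSet (A : ι → Set α) (K : Finset ι) : Set α := {x | ∀ k, x ∈ A k → k ∈ K}

lemma natRk_transversalMatroid_le {S : Set α} {K : Finset ι} (hS : S ⊆ confinedSet A K) :
    (transversalMatroid A).natRk S ≤ K.card := by
  obtain ⟨I, hIS, ⟨φ, hφ, hφA⟩, hI⟩ := (transversalMatroid A).exists_indep_ncard_eq_natRk S
  classical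
  have := Fintype.ofFinite I
  rw [← hI, ← Nat.card_coe_set_eq, Nat.card_eq_fintype_card, ← Finset.card_univ,
    ← Finset.card_image_of_injective _ hφ]
  refine Finset.card_le_card fun k hk => ?_
  obtain ⟨x, -, rfl⟩ := Finset.mem_image.1 hk
  exact hS (hIS x.2) _ (hφA x)

lemma indep_image_transversalMatroid {K : Finset ι} {g : ι → α}
    (hgA : ∀ k ∈ K, g k ∈ A k) : (transversalMatroid A).Indep (g '' K) := by
  refine ⟨fun x => x.2.choose, fun x y hxy => ?_, fun x => ?_⟩
  · have h : x.2.choose = y.2.choose := hxy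
    have h1 := x.2.choose_spec.2
    rw [h, y.2.choose_spec.2] at h1
    exact Subtype.ext h1.symm
  · have h := hgA _ x.2.choose_spec.1
    rwa [x.2.choose_spec.2] at h

lemma card_le_natRk_transversalMatroid {S : Set α} {K : Finset ι} {g : ι → α}
    (hg : Set.InjOn g K) (hgA : ∀ k ∈ K, g k ∈ A k) (hgS : ∀ k ∈ K, g k ∈ S) :
    K.card ≤ (transversalMatroid A).natRk S := by
  have h := (transversalMatroid A).natRk_mono (Set.image_subset_iff.2 hgS : g '' K ⊆ S)
  rwa [(indep_image_transversalMatroid hgA).natRk_eq_ncard, hg.ncard_image,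
    Set.ncard_coe_finset] at h

/-- If a partial transversal inside the confined set represents all indices of `K`, then the
confined set is a flat: any further element could be added to this partial transversal. -/
lemma isFlat_confinedSet {K : Finset ι} {g : ι → α} (hg : Set.InjOn g K)
    (hgA : ∀ k ∈ K, g k ∈ A k) (hgK : ∀ k ∈ K, g k ∈ confinedSet A K) :
    (transversalMatroid A).IsFlat (confinedSet A K) := by
  classical
  rw [isFlat_iff_closure_eq]
  have hsub := (transversalMatroid A).subset_closure (confinedSet A K) (Set.subset_univ _)
  refine Set.Subset.antisymm (fun x hx => ?_) hsub
  by_contra hxK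
  obtain ⟨k₀, hxk, hk₀⟩ : ∃ k, x ∈ A k ∧ k ∉ K := by
    simpa [confinedSet] using hxK
  have hne : ∀ k ∈ K, k ≠ k₀ := fun k hk h => hk₀ (h ▸ hk)
  have hnx : ∀ k ∈ K, g k ≠ x := fun k hk h => hxK (h ▸ hgK k hk)
  have h1 : (insert k₀ K).card ≤
      (transversalMatroid A).natRk ((transversalMatroid A).closure (confinedSet A K)) := by
    refine card_le_natRk_transversalMatroid (g := Function.update g k₀ x) ?_ ?_ ?_
    · intro p hp q hq hpq
      simp only [Finset.coe_insert, Set.mem_insert_iff, Finset.mem_coe] at hp hq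
      rcases hp with rfl | hp <;> rcases hq with rfl | hq
      · rfl
      · rw [Function.update_self, Function.update_of_ne (hne q hq)] at hpq
        exact absurd hpq.symm (hnx q hq)
      · rw [Function.update_self, Function.update_of_ne (hne p hp)] at hpq
        exact absurd hpq (hnx p hp)
      · rw [Function.update_of_ne (hne p hp), Function.update_of_ne (hne q hq)] at hpq
        exact hg hp hq hpq
    · intro p hp
      rcases Finset.mem_insert.1 hp with rfl | hp
      · rwa [Function.update_self]
      · rw [Function.update_of_ne (hne p hp)]
        exact hgA p hp
    · intro p hp
      rcases Finset.mem_insert.1 hp with rfl | hp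
      · rwa [Function.update_self]
      · rw [Function.update_of_ne (hne p hp)]
        exact hsub (hgK p hp)
  have h2 := natRk_transversalMatroid_le (A := A) (subset_refl (confinedSet A K))
  rw [natRk_closure, Finset.card_insert_of_notMem hk₀] at h1
  omega

/-- By Hall's theorem, a circuit has more elements than there are members of the set system that
meet it. -/
lemma exists_card_lt_of_isCircuit [Fintype ι] {C : Set α} (hC : (transversalMatroid A).IsCircuit C) :
    ∃ K : Finset ι, (∀ k, k ∈ K ↔ ∃ x ∈ C, x ∈ A k) ∧ K.card < C.ncard := by
  classical
  have hdep : ¬ IsPartialTransversal A C := hC.not_indep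
  have hall := (Finset.all_card_le_biUnion_card_iff_exists_injective
    fun x : C => Finset.univ.filter fun k => (x : α) ∈ A k).not.2 (by
      rintro ⟨φ, hφ, h⟩
      exact hdep ⟨φ, hφ, fun x => (Finset.mem_filter.1 (h x)).2⟩)
  push Not at hall
  obtain ⟨s, hs⟩ := hall
  set K := s.biUnion fun x : C => Finset.univ.filter fun k => (x : α) ∈ A k with hK
  have hmem : ∀ k, k ∈ K ↔ ∃ x ∈ (Subtype.val '' (s : Set C) : Set α), x ∈ A k := by
    intro k
    simp only [hK, Finset.mem_biUnion, Finset.mem_filter, Finset.mem_univ, true_and]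
    constructor
    · rintro ⟨x, hx, hxk⟩
      exact ⟨x, ⟨x, hx, rfl⟩, hxk⟩
    · rintro ⟨_, ⟨x, hx, rfl⟩, hxk⟩
      exact ⟨x, hx, hxk⟩
  have hcard : (Subtype.val '' (s : Set C) : Set α).ncard = s.card := by
    rw [Set.ncard_image_of_injective _ Subtype.val_injective, Set.ncard_coe_finset]
  -- A subset violating Hall's condition is dependent, so it is the whole circuit.
  have hsC : (Subtype.val '' (s : Set C) : Set α) = C := by
    refine hC.eq_of_not_indep_subset (fun hi => ?_) (by rintro _ ⟨x, -, rfl⟩; exact x.2)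
    have h1 := natRk_transversalMatroid_le (A := A) (S := Subtype.val '' (s : Set C)) (K := K)
      fun x hx k hxk => (hmem k).2 ⟨x, hx, hxk⟩
    rw [hi.natRk_eq_ncard, hcard] at h1
    omega
  rw [hsC] at hmem hcard
  exact ⟨K, hmem, by omega⟩

/-- A member of the set system that meets a circuit meets it at least twice. -/
lemma exists_ne_mem_of_isCircuit [Fintype ι] {C : Set α} (hC : (transversalMatroid A).IsCircuit C)
    {x : α} (hx : x ∈ C) {k : ι} (hxk : x ∈ A k) : ∃ y ∈ C, y ≠ x ∧ y ∈ A k := by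
  classical
  by_contra! h
  obtain ⟨K, hK, hcard⟩ := exists_card_lt_of_isCircuit hC
  have hpos := Finset.card_pos.2 ⟨k, (hK k).2 ⟨x, hx, hxk⟩⟩
  have h1 := natRk_transversalMatroid_le (A := A) (S := C \ {x}) (K := K.erase k)
    fun y hy p hyp => Finset.mem_erase.2
      ⟨fun hpk => h y hy.1 hy.2 (hpk ▸ hyp), (hK p).2 ⟨y, hy.1, hyp⟩⟩
  rw [(hC.sdiff_singleton_indep hx).natRk_eq_ncard,
    Finset.card_erase_of_mem ((hK k).2 ⟨x, hx, hxk⟩)] at h1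
  have h2 := Set.ncard_sdiff_singleton_add_one hx (Set.toFinite C)
  omega

end Transversal

/-! ### Transversal matroids of intervals -/

/-- The indices `k` with `i ≤ k < j`. -/
def indexRange (r i j : ℕ) : Finset (Fin r) :=
  Finset.univ.filter fun k : Fin r => i ≤ (k : ℕ) ∧ (k : ℕ) < j

lemma mem_indexRange {r i j : ℕ} {k : Fin r} :
    k ∈ indexRange r i j ↔ i ≤ (k : ℕ) ∧ (k : ℕ) < j := by
  simp [indexRange]

lemma card_indexRange {r i j : ℕ} (hj : j ≤ r) : (indexRange r i j).card = j - i := by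
  rw [← Nat.card_Ico, ← Finset.card_map Fin.valEmbedding]
  congr 1
  ext p
  simp only [Finset.mem_map, mem_indexRange, Fin.valEmbedding_apply, Finset.mem_Ico]
  exact ⟨fun ⟨k, hk, hkp⟩ => hkp ▸ hk, fun hp => ⟨⟨p, by omega⟩, hp, rfl⟩⟩

section Intervals

open Matroid

variable {n r : ℕ} {l u : Fin r → Fin n}

/-- The transversal matroid presented by the intervals `[lₖ, uₖ]`. -/
abbrev intervalMatroid (l u : Fin r → Fin n) : Matroid (Fin n) :=
  transversalMatroid fun k => Set.Icc (l k) (u k)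

/-- The elements that lie in none of the intervals `[lₖ, uₖ]` except those with `i ≤ k < j`. -/
def intervalFlat (l u : Fin r → Fin n) (i j : ℕ) : Set (Fin n) :=
  confinedSet (fun k => Set.Icc (l k) (u k)) (indexRange r i j)

lemma mem_intervalFlat {i j : ℕ} {x : Fin n} :
    x ∈ intervalFlat l u i j ↔ ∀ k, l k ≤ x → x ≤ u k → i ≤ (k : ℕ) ∧ (k : ℕ) < j := by
  simp [intervalFlat, confinedSet, mem_indexRange]

lemma intervalFlat_mono {i i' j j' : ℕ} (hi : i' ≤ i) (hj : j ≤ j') :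
    intervalFlat l u i j ⊆ intervalFlat l u i' j' := fun x hx => by
  rw [mem_intervalFlat] at hx ⊢
  intro k h1 h2
  have := hx k h1 h2
  omega

lemma intervalFlat_inter (i j : ℕ) :
    intervalFlat l u 0 j ∩ intervalFlat l u i r = intervalFlat l u i j := by
  ext x
  simp only [Set.mem_inter_iff, mem_intervalFlat]
  constructor
  · exact fun ⟨h1, h2⟩ k hk hk' => ⟨(h2 k hk hk').1, (h1 k hk hk').2⟩
  · exact fun h => ⟨fun k hk hk' => ⟨Nat.zero_le _, (h k hk hk').2⟩,
      fun k hk hk' => ⟨(h k hk hk').1, k.2⟩⟩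

lemma intervalFlat_zero_self : intervalFlat l u 0 r = Set.univ :=
  Set.eq_univ_of_forall fun _ => mem_intervalFlat.2 fun k _ _ => ⟨Nat.zero_le _, k.2⟩

lemma natRk_le_of_subset_intervalFlat {i j : ℕ} (hj : j ≤ r) {S : Set (Fin n)}
    (hS : S ⊆ intervalFlat l u i j) :
    (intervalMatroid l u).natRk S ≤ j - i := by
  rw [← card_indexRange hj]
  exact natRk_transversalMatroid_le hS

lemma isFlat_intervalFlat_zero (hl : StrictMono l) (hlu : ∀ k, l k ≤ u k) (j : ℕ) :
    (intervalMatroid l u).IsFlat (intervalFlat l u 0 j) := by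
  refine isFlat_confinedSet hl.injective.injOn (fun k _ => ⟨le_rfl, hlu k⟩) fun k hk => ?_
  refine mem_intervalFlat.2 fun p hp _ => ⟨Nat.zero_le _, ?_⟩
  exact lt_of_le_of_lt (hl.le_iff_le.1 hp) (mem_indexRange.1 hk).2

lemma isFlat_intervalFlat_top (hu : StrictMono u) (hlu : ∀ k, l k ≤ u k) (i : ℕ) :
    (intervalMatroid l u).IsFlat (intervalFlat l u i r) := by
  refine isFlat_confinedSet hu.injective.injOn (fun k _ => ⟨hlu k, le_rfl⟩) fun k hk => ?_
  refine mem_intervalFlat.2 fun p _ hp => ⟨?_, p.2⟩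
  exact (mem_indexRange.1 hk).1.trans (hu.le_iff_le.1 hp)

/-- The intervals met by a circuit are consecutive: otherwise an interval that is skipped would
split the circuit into two independent parts with disjoint sets of intervals. -/
lemma mem_of_isCircuit_of_lt_of_lt (hl : StrictMono l) (hu : StrictMono u) {C : Set (Fin n)}
    (hC : (intervalMatroid l u).IsCircuit C) {p k q : Fin r}
    (hpk : p < k) (hkq : k < q) (hp : ∃ x ∈ C, x ∈ Set.Icc (l p) (u p))
    (hq : ∃ x ∈ C, x ∈ Set.Icc (l q) (u q)) : ∃ x ∈ C, x ∈ Set.Icc (l k) (u k) := by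
  by_contra! hk
  have : Nonempty (Fin r) := ⟨k⟩
  have hside : ∀ x ∈ C, x < l k ∨ u k < x := by
    intro x hx
    have := hk x hx
    rw [Set.mem_Icc, not_and_or, not_le, not_le] at this
    exact this
  obtain ⟨x, hxC, hx⟩ := hp
  obtain ⟨y, hyC, hy⟩ := hq
  have hxu : ¬ u k < x := not_lt.2 (hx.2.trans (hu hpk).le)
  have hyl : ¬ y < l k := not_lt.2 ((hl hkq).le.trans hy.1)
  have h₁ := hC.ssubset_indep (X := {z ∈ C | z < l k})
    ((Set.ssubset_iff_of_subset (Set.sep_subset _ _)).2 ⟨y, hyC, fun h => hyl h.2⟩)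
  have h₂ := hC.ssubset_indep (X := {z ∈ C | u k < z})
    ((Set.ssubset_iff_of_subset (Set.sep_subset _ _)).2 ⟨x, hxC, fun h => hxu h.2⟩)
  obtain ⟨f, hf, hfA⟩ := (isPartialTransversal_iff (fun k => Set.Icc (l k) (u k)) _).1 h₁
  obtain ⟨g, hg, hgA⟩ := (isPartialTransversal_iff (fun k => Set.Icc (l k) (u k)) _).1 h₂
  have hfk : ∀ z ∈ C, z < l k → f z < k := fun z hz hzk =>
    hl.lt_iff_lt.1 ((hfA z ⟨hz, hzk⟩).1.trans_lt hzk)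
  have hgk : ∀ z ∈ C, u k < z → k < g z := fun z hz hzk =>
    hu.lt_iff_lt.1 (hzk.trans_le (hgA z ⟨hz, hzk⟩).2)
  refine hC.not_indep ((isPartialTransversal_iff (fun k => Set.Icc (l k) (u k)) _).2
    ⟨fun z => if z < l k then f z else g z, ?_, ?_⟩)
  · intro z hz w hw hzw
    simp only at hzw
    split_ifs at hzw with h1 h2 h2
    · exact hf ⟨hz, h1⟩ ⟨hw, h2⟩ hzw
    · exact absurd hzw ((hfk z hz h1).trans (hgk w hw ((hside w hw).resolve_left h2))).ne
    · exact absurd hzw ((hfk w hw h2).trans (hgk z hz ((hside z hz).resolve_left h1))).ne'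
    · exact hg ⟨hz, (hside z hz).resolve_left h1⟩ ⟨hw, (hside w hw).resolve_left h2⟩ hzw
  · intro z hz
    simp only
    split_ifs with h1
    · exact hfA z ⟨hz, h1⟩
    · exact hgA z ⟨hz, (hside z hz).resolve_left h1⟩

/-- By Hall's theorem the flat of the consecutive intervals that a circuit meets has at most the rank
of the circuit, so it is the closure of the circuit. -/
lemma exists_closure_eq_intervalFlat (hl : StrictMono l) (hu : StrictMono u)
    (hlu : ∀ k, l k ≤ u k) {C : Set (Fin n)}
    (hC : (intervalMatroid l u).IsCircuit C) :
    ∃ i j, i ≤ r ∧ j ≤ r ∧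
      (intervalMatroid l u).closure C = intervalFlat l u i j := by
  obtain ⟨K, hK, hcard⟩ := exists_card_lt_of_isCircuit hC
  obtain ⟨i, j, hi, hj, hKij⟩ : ∃ i j, i ≤ r ∧ j ≤ r ∧ K = indexRange r i j := by
    rcases K.eq_empty_or_nonempty with rfl | hne
    · refine ⟨0, 0, Nat.zero_le _, Nat.zero_le _, ?_⟩
      ext k
      simp [mem_indexRange]
    · refine ⟨K.min' hne, K.max' hne + 1, (K.min' hne).2.le, (K.max' hne).2, ?_⟩
      ext k
      rw [mem_indexRange]
      constructor
      · exact fun hk => ⟨K.min'_le k hk, Nat.lt_succ_of_le (K.le_max' k hk)⟩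
      · rintro ⟨h1, h2⟩
        rcases (Fin.le_def.2 h1).eq_or_lt with h1 | h1
        · exact h1 ▸ K.min'_mem hne
        rcases (Fin.le_def.2 (Nat.le_of_lt_succ h2)).eq_or_lt with h2 | h2
        · exact h2 ▸ K.max'_mem hne
        exact (hK k).2 (mem_of_isCircuit_of_lt_of_lt hl hu hC h1 h2
          ((hK _).1 (K.min'_mem hne)) ((hK _).1 (K.max'_mem hne)))
  refine ⟨i, j, hi, hj, ?_⟩
  have hsub : C ⊆ intervalFlat l u i j := fun x hx k hk => by
    rw [← hKij]
    exact (hK k).2 ⟨x, hx, hk⟩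
  have hflat : (intervalMatroid l u).IsFlat (intervalFlat l u i j) := by
    rw [← intervalFlat_inter]
    exact (isFlat_intervalFlat_zero hl hlu j).inter (isFlat_intervalFlat_top hu hlu i)
  rw [← hflat.closure]
  refine (isRkFinite_set _ C).closure_eq_closure_of_subset_of_eRk_ge_eRk hsub ?_
  have h1 := natRk_le_of_subset_intervalFlat (l := l) (u := u) hj
    (subset_refl (intervalFlat l u i j))
  have h2 := hC.natRk_add_one
  rw [hKij, card_indexRange hj] at hcard
  rw [← coe_natRk, ← coe_natRk]
  exact_mod_cast (by omega)

/-- If the left endpoints of the intervals `p` and `p + 1` are adjacent, then interval `p` has only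
one element in the flat of the first `p + 1` intervals, so no circuit there uses it. -/
lemma cyclicPart_intervalFlat_zero_subset (hu : StrictMono u) {p q : Fin r}
    (hpq : (q : ℕ) = p + 1) (h : (l q : ℕ) = l p + 1) :
    (intervalMatroid l u).cyclicPart (intervalFlat l u 0 q) ⊆
      (intervalMatroid l u).cyclicPart (intervalFlat l u 0 p) := by
  rw [cyclicPart_subset_cyclicPart_iff]
  intro C hC hCq
  have hlt : p < q := Fin.lt_def.2 (by omega)
  have key : ∀ x ∈ C, x ∈ Set.Icc (l p) (u p) → x = l p := by
    intro x hx hxp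
    refine le_antisymm ?_ hxp.1
    by_contra hxl
    have hxq : l q ≤ x := by
      rw [not_le, Fin.lt_def] at hxl
      rw [Fin.le_def]
      omega
    exact absurd (mem_intervalFlat.1 (hCq hx) q hxq (hxp.2.trans (hu hlt).le)).2 (lt_irrefl _)
  intro x hx
  refine mem_intervalFlat.2 fun k hk hk' => ⟨Nat.zero_le _, ?_⟩
  have hkq := (mem_intervalFlat.1 (hCq hx) k hk hk').2
  by_contra hkp
  obtain rfl : k = p := Fin.ext (by omega)
  obtain ⟨y, hyC, hyx, hyk⟩ := exists_ne_mem_of_isCircuit hC hx ⟨hk, hk'⟩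
  exact hyx ((key y hyC hyk).trans (key x hx ⟨hk, hk'⟩).symm)

/-- The mirror image of `cyclicPart_intervalFlat_zero_subset`. -/
lemma cyclicPart_intervalFlat_top_subset (hl : StrictMono l) {p q : Fin r}
    (hpq : (q : ℕ) = p + 1) (h : (u q : ℕ) = u p + 1) :
    (intervalMatroid l u).cyclicPart (intervalFlat l u q r) ⊆
      (intervalMatroid l u).cyclicPart (intervalFlat l u (q + 1) r) := by
  rw [cyclicPart_subset_cyclicPart_iff]
  intro C hC hCq
  have hlt : p < q := Fin.lt_def.2 (by omega)
  have key : ∀ x ∈ C, x ∈ Set.Icc (l q) (u q) → x = u q := by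
    intro x hx hxq
    refine le_antisymm hxq.2 ?_
    by_contra hxu
    have hxp : x ≤ u p := by
      rw [not_le, Fin.lt_def] at hxu
      rw [Fin.le_def]
      omega
    have := (mem_intervalFlat.1 (hCq hx) p ((hl hlt).le.trans hxq.1) hxp).1
    omega
  intro x hx
  refine mem_intervalFlat.2 fun k hk hk' => ⟨?_, k.2⟩
  have hkq := (mem_intervalFlat.1 (hCq hx) k hk hk').1
  by_contra hkp
  obtain rfl : k = q := Fin.ext (by omega)
  obtain ⟨y, hyC, hyx, hyk⟩ := exists_ne_mem_of_isCircuit hC hx ⟨hk, hk'⟩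
  exact hyx ((key y hyC hyk).trans (key x hx ⟨hk, hk'⟩).symm)

/-- Two elements of the same interval lie in a common circuit: the left endpoints of the earlier
intervals and the right endpoints of the later ones are completed to a basis by either of them. -/
lemma exists_isCircuit_of_mem_Icc (hl : StrictMono l) (hu : StrictMono u)
    (hlu : ∀ k, l k ≤ u k) {k : Fin r} {x y : Fin n} (hx : x ∈ Set.Icc (l k) (u k))
    (hy : y ∈ Set.Icc (l k) (u k)) (hxy : x ≠ y) :
    ∃ C, (intervalMatroid l u).IsCircuit C ∧ x ∈ C ∧ y ∈ C := by
  classical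
  let h : Fin r → Fin n := fun p => if p < k then l p else u p
  have hlt : ∀ p, p < k → h p = l p := fun p hp => if_pos hp
  have hgt : ∀ p, k < p → h p = u p := fun p hp => if_neg hp.not_gt
  have hne : ∀ z ∈ Set.Icc (l k) (u k), ∀ p, p ≠ k → h p ≠ z := by
    intro z hz p hp
    rcases hp.lt_or_gt with hp | hp
    · rw [hlt p hp]
      exact ((hl hp).trans_le hz.1).ne
    · rw [hgt p hp]
      exact (hz.2.trans_lt (hu hp)).ne'
  have hmono : StrictMono h := by
    intro p q hpq
    simp only [h]
    split_ifs with h1 h2 h2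
    · exact hl hpq
    · exact (hl hpq).trans_le (hlu q)
    · exact absurd (hpq.trans h2) h1
    · exact hu hpq
  let I : Set (Fin n) := h '' (Finset.univ.erase k : Finset (Fin r))
  have hI : ∀ z ∈ Set.Icc (l k) (u k), z ∉ I := by
    rintro z hz ⟨p, hp, hpz⟩
    exact hne z hz p (Finset.ne_of_mem_erase hp) hpz
  have hins : ∀ z, insert z I =
      Function.update h k z '' (Finset.univ : Finset (Fin r)) := by
    intro z
    ext w
    constructor
    · rintro (rfl | ⟨p, hp, rfl⟩)
      · exact ⟨k, by simp, Function.update_self _ _ _⟩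
      · exact ⟨p, by simp, Function.update_of_ne (Finset.ne_of_mem_erase hp) _ _⟩
    · rintro ⟨p, -, rfl⟩
      by_cases hp : p = k
      · subst hp
        exact Or.inl (Function.update_self _ _ _)
      · rw [Function.update_of_ne hp]
        exact Or.inr ⟨p, Finset.mem_erase.2 ⟨hp, Finset.mem_univ p⟩, rfl⟩
  have hind : ∀ z ∈ Set.Icc (l k) (u k), (intervalMatroid l u).Indep (insert z I) := by
    intro z hz
    rw [hins]
    refine indep_image_transversalMatroid ?_
    intro p _
    by_cases hp : p = k
    · subst hp
      rwa [Function.update_self]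
    · rw [Function.update_of_ne hp]
      rcases lt_or_gt_of_ne hp with hp | hp
      · rw [hlt p hp]
        exact ⟨le_rfl, hlu p⟩
      · rw [hgt p hp]
        exact ⟨hlu p, le_rfl⟩
  refine exists_isCircuit_of_exchange (hI x hx) (hI y hy) hxy (hind x hx) (hind y hy) ?_
  have h1 := natRk_le_of_subset_intervalFlat (l := l) (u := u) le_rfl
    (S := Set.univ) intervalFlat_zero_self.superset
  have h2 : I.ncard = r - 1 := by
    rw [Set.ncard_image_of_injective _ hmono.injective, Set.ncard_coe_finset,
      Finset.card_erase_of_mem (Finset.mem_univ k), Finset.card_univ, Fintype.card_fin]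
  rw [transversalMatroid_ground]
  omega

end Intervals

/-! ### Modularity in terms of the intervals -/

section Intervals

open Matroid

variable {n r : ℕ} {l u : Fin r → Fin n}

lemma Matroid.IsConnectedComponent.mem_of_isCircuit {α : Type*} {M : Matroid α} [M.Finite]
    {X C : Set α} (hX : M.IsConnectedComponent X) (hC : M.IsCircuit C) {x y : α} (hx : x ∈ X)
    (hxC : x ∈ C) (hyC : y ∈ C) : y ∈ X := by
  obtain ⟨e, -, rfl⟩ := hX
  rcases hx with rfl | ⟨C', hC', heC', hxC'⟩
  · exact Or.inr ⟨C, hC, hxC, hyC⟩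
  · exact Or.inr (hC'.exists_isCircuit_of_inter_nonempty hC heC' hyC ⟨x, hxC', hxC⟩)

lemma Icc_subset_of_isConnectedComponent (hl : StrictMono l) (hu : StrictMono u)
    (hlu : ∀ k, l k ≤ u k) {X : Set (Fin n)} (hX : (intervalMatroid l u).IsConnectedComponent X)
    {k : Fin r} {x : Fin n} (hx : x ∈ X) (hxk : x ∈ Set.Icc (l k) (u k)) :
    Set.Icc (l k) (u k) ⊆ X := by
  intro y hy
  by_cases hxy : x = y
  · exact hxy ▸ hx
  · obtain ⟨C, hC, hxC, hyC⟩ := exists_isCircuit_of_mem_Icc hl hu hlu hxk hy hxy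
    exact hX.mem_of_isCircuit hC hx hxC hyC

/-- Consecutively overlapping intervals lie in one connected component. -/
lemma exists_isConnectedComponent_of_overlap (hl : StrictMono l) (hu : StrictMono u)
    (hlu : ∀ k, l k ≤ u k) {p q : Fin r} (hpq : p ≤ q)
    (hov : ∀ k k' : Fin r, p ≤ k → (k' : ℕ) = k + 1 → k' ≤ q → l k' ≤ u k) :
    ∃ X, (intervalMatroid l u).IsConnectedComponent X ∧
      ∀ k, p ≤ k → k ≤ q → Set.Icc (l k) (u k) ⊆ X := by
  refine ⟨_, ⟨l p, Set.mem_univ _, rfl⟩, ?_⟩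
  set X : Set (Fin n) := {f | f = l p ∨ ∃ C, (intervalMatroid l u).IsCircuit C ∧ l p ∈ C ∧ f ∈ C}
  have hX : (intervalMatroid l u).IsConnectedComponent X := ⟨l p, Set.mem_univ _, rfl⟩
  have key : ∀ d : ℕ, ∀ k : Fin r, (k : ℕ) = p + d → k ≤ q → Set.Icc (l k) (u k) ⊆ X := by
    intro d
    induction d with
    | zero =>
      intro k hk _
      obtain rfl : k = p := Fin.ext hk
      exact Icc_subset_of_isConnectedComponent hl hu hlu hX (Or.inl rfl) ⟨le_rfl, hlu k⟩
    | succ d ih =>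
      intro k hk hkq
      have hkr := k.2
      let k₀ : Fin r := ⟨p + d, by omega⟩
      have h0 : (k : ℕ) = (k₀ : ℕ) + 1 := hk
      have h1 : k₀ < k := Fin.lt_def.2 (by omega)
      have h2 := ih k₀ rfl (h1.le.trans hkq)
      have h3 := hov k₀ k (Fin.le_def.2 (Nat.le_add_right _ _)) h0 hkq
      exact Icc_subset_of_isConnectedComponent hl hu hlu hX (h2 ⟨(hl h1).le, h3⟩)
        ⟨le_rfl, hlu k⟩
  intro k hpk hkq
  exact key (k - p) k (by have := Fin.le_def.1 hpk; omega) hkq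

/-- If the flat of the intervals with `i ≤ k < j` has the full rank `j - i`, and if the flats of the
intervals before `j` and from `i` on together cover everything, then these two flats form a modular
pair. -/
lemma modular_intervalFlat (hl : StrictMono l) (hlu : ∀ k, l k ≤ u k) {i j : ℕ} (hij : i ≤ j)
    (hj : j ≤ r) (hrk : j - i ≤ (intervalMatroid l u).natRk (intervalFlat l u i j))
    (hcov : intervalFlat l u 0 j ∪ intervalFlat l u i r = Set.univ) :
    (intervalMatroid l u).natRk (intervalFlat l u 0 j) +
        (intervalMatroid l u).natRk (intervalFlat l u i r) ≤
      (intervalMatroid l u).natRk (intervalFlat l u 0 j ∪ intervalFlat l u i r) +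
        (intervalMatroid l u).natRk (intervalFlat l u 0 j ∩ intervalFlat l u i r) := by
  rw [intervalFlat_inter, hcov]
  have h1 := natRk_le_of_subset_intervalFlat (l := l) (u := u) hj
    (subset_refl (intervalFlat l u 0 j))
  have h2 := natRk_le_of_subset_intervalFlat (l := l) (u := u) le_rfl
    (subset_refl (intervalFlat l u i r))
  have h3 := card_le_natRk_transversalMatroid (A := fun k => Set.Icc (l k) (u k))
    (S := Set.univ) (K := Finset.univ) (g := l) hl.injective.injOn
    (fun k _ => ⟨le_rfl, hlu k⟩) (fun _ _ => Set.mem_univ _)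
  rw [Finset.card_univ, Fintype.card_fin] at h3
  change r ≤ (intervalMatroid l u).natRk Set.univ at h3
  omega

/-- The flats of the first `j` and of the intervals from `i ≥ j` on are skew. -/
lemma modular_intervalFlat_of_le (hl : StrictMono l) (hu : StrictMono u) (hlu : ∀ k, l k ≤ u k)
    {i j : ℕ} (hji : j ≤ i) (hi : i ≤ r) :
    (intervalMatroid l u).natRk (intervalFlat l u 0 j) +
        (intervalMatroid l u).natRk (intervalFlat l u i r) ≤
      (intervalMatroid l u).natRk (intervalFlat l u 0 j ∪ intervalFlat l u i r) +
        (intervalMatroid l u).natRk (intervalFlat l u 0 j ∩ intervalFlat l u i r) := by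
  have h1 := natRk_le_of_subset_intervalFlat (l := l) (u := u) (hji.trans hi)
    (subset_refl (intervalFlat l u 0 j))
  have h2 := natRk_le_of_subset_intervalFlat (l := l) (u := u) le_rfl
    (subset_refl (intervalFlat l u i r))
  have h3 := card_le_natRk_transversalMatroid (A := fun k => Set.Icc (l k) (u k))
    (S := intervalFlat l u 0 j ∪ intervalFlat l u i r) (K := indexRange r 0 j ∪ indexRange r i r)
    (g := fun k => if (k : ℕ) < j then l k else u k) ?_ ?_ ?_
  · rw [Finset.card_union_of_disjoint, card_indexRange (hji.trans hi), card_indexRange le_rfl] at h3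
    · change _ ≤ (intervalMatroid l u).natRk _ at h3
      omega
    · refine Finset.disjoint_left.2 fun k hk hk' => ?_
      rw [mem_indexRange] at hk hk'
      omega
  · refine StrictMono.injective (fun p q hpq => ?_) |>.injOn
    have hpq' := Fin.lt_def.1 hpq
    split_ifs with h1 h2 h2
    · exact hl hpq
    · exact (hl hpq).trans_le (hlu q)
    · omega
    · exact hu hpq
  · intro k _
    split_ifs
    · exact ⟨le_rfl, hlu k⟩
    · exact ⟨hlu k, le_rfl⟩
  · intro k hk
    split_ifs with hkj
    · refine Or.inl (mem_intervalFlat.2 fun p hp _ => ⟨Nat.zero_le _, ?_⟩)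
      exact lt_of_le_of_lt (Fin.le_def.1 (hl.le_iff_le.1 hp)) hkj
    · refine Or.inr (mem_intervalFlat.2 fun p _ hp => ⟨?_, p.2⟩)
      have hki : i ≤ (k : ℕ) := by
        rw [Finset.mem_union, mem_indexRange, mem_indexRange] at hk
        omega
      exact hki.trans (Fin.le_def.1 (hu.le_iff_le.1 hp))

/-- If interval `p` ends before interval `p + 1` begins, with `i ≤ p + 1 ≤ j`, then right endpoints
up to `p` and left endpoints after `p` represent the intervals from `i` to `j` in their flat. -/
lemma modular_intervalFlat_of_gap (hl : StrictMono l) (hu : StrictMono u) (hlu : ∀ k, l k ≤ u k)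
    {i j : ℕ} (hj : j < r) {p q : Fin r} (hpq : (q : ℕ) = p + 1) (hgap : u p < l q)
    (hi : i ≤ q) (hqj : q ≤ j) :
    j - i ≤ (intervalMatroid l u).natRk (intervalFlat l u i j) ∧
      intervalFlat l u 0 j ∪ intervalFlat l u i r = Set.univ := by
  -- An element below `l q` lies in intervals up to `p` only, one above `u p` in later ones only.
  have below : ∀ x k, x < l q → l k ≤ x → (k : ℕ) < j := by
    intro x k hx hk
    have := Fin.lt_def.1 (hl.lt_iff_lt.1 (hk.trans_lt hx))
    omega
  have above : ∀ x k, u p < x → x ≤ u k → i ≤ (k : ℕ) := by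
    intro x k hx hk
    have := Fin.lt_def.1 (hu.lt_iff_lt.1 (hx.trans_le hk))
    omega
  constructor
  · rw [← card_indexRange hj.le]
    refine card_le_natRk_transversalMatroid (g := fun k => if k < q then u k else l k) ?_ ?_ ?_
    · refine StrictMono.injective (fun k k' hk => ?_) |>.injOn
      split_ifs with h1 h2 h2
      · exact hu hk
      · have hkp : k ≤ p := Fin.le_def.2 (by have := Fin.lt_def.1 h1; omega)
        exact (hu.monotone hkp).trans_lt (hgap.trans_le (hl.monotone (not_lt.1 h2)))
      · exact absurd (hk.trans h2) h1
      · exact hl hk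
    · intro k _
      split_ifs
      · exact ⟨hlu k, le_rfl⟩
      · exact ⟨le_rfl, hlu k⟩
    · intro k hk
      rw [mem_indexRange] at hk
      split_ifs with h1
      · have hkp : k ≤ p := Fin.le_def.2 (by have := Fin.lt_def.1 h1; omega)
        refine mem_intervalFlat.2 fun k' h2 h3 =>
          ⟨hk.1.trans (Fin.le_def.1 (hu.le_iff_le.1 h3)), ?_⟩
        exact below _ k' ((hu.monotone hkp).trans_lt hgap) h2
      · refine mem_intervalFlat.2 fun k' h2 h3 =>
          ⟨?_, lt_of_le_of_lt (Fin.le_def.1 (hl.le_iff_le.1 h2)) hk.2⟩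
        exact above _ k' (hgap.trans_le (hl.monotone (not_lt.1 h1))) h3
  · refine Set.eq_univ_of_forall fun x => ?_
    by_cases hx : x < l q
    · exact Or.inl (mem_intervalFlat.2 fun k hk _ => ⟨Nat.zero_le _, below x k hx hk⟩)
    · exact Or.inr (mem_intervalFlat.2 fun k _ hk =>
        ⟨above x k (hgap.trans_le (not_lt.1 hx)) hk, k.2⟩)

/-- Let `X` be a union of intervals and of elements outside all intervals that contains the
intervals from `i` to `j - 1`. If the parts of `X` up to `a = lⱼ - 1` and from `b = uᵢ₋₁ + 1` on are
modular, then a maximal number of the intervals in `X` is represented in their intersection, which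
forces the intervals from `i` to `j - 1` to be represented there. -/
lemma modular_intervalFlat_of_modular_restrict (hl : StrictMono l) (hu : StrictMono u)
    (hlu : ∀ k, l k ≤ u k) {X : Set (Fin n)}
    (hX : ∀ k x, x ∈ X → x ∈ Set.Icc (l k) (u k) → Set.Icc (l k) (u k) ⊆ X) {i j : Fin r}
    (hij : i < j) (hXij : ∀ k, i ≤ k → k < j → Set.Icc (l k) (u k) ⊆ X) {a b : Fin n} {i₀ : Fin r}
    (hi₀ : (i : ℕ) = i₀ + 1) (ha : (l j : ℕ) = a + 1) (hb : (b : ℕ) = u i₀ + 1)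
    (hmod : (intervalMatroid l u).natRk {x ∈ X | x ≤ a} +
        (intervalMatroid l u).natRk {x ∈ X | b ≤ x} =
      (intervalMatroid l u).natRk ({x ∈ X | x ≤ a} ∪ {x ∈ X | b ≤ x}) +
        (intervalMatroid l u).natRk ({x ∈ X | x ≤ a} ∩ {x ∈ X | b ≤ x})) :
    (j : ℕ) - i ≤ (intervalMatroid l u).natRk (intervalFlat l u i j) ∧
      intervalFlat l u 0 j ∪ intervalFlat l u i r = Set.univ := by
  classical
  have below : ∀ x k, x ≤ a → l k ≤ x → k < j := fun x k hx hk => hl.lt_iff_lt.1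
    (hk.trans_lt (Fin.lt_def.2 (by have := Fin.le_def.1 hx; omega)))
  have above : ∀ x k, b ≤ x → x ≤ u k → i ≤ k := fun x k hx hk => by
    have h1 : i₀ < k := hu.lt_iff_lt.1
      (lt_of_lt_of_le (Fin.lt_def.2 (by have := Fin.le_def.1 hx; omega)) hk)
    exact Fin.le_def.2 (by have := Fin.lt_def.1 h1; omega)
  let K : Finset (Fin r) := Finset.univ.filter fun k => l k ∈ X
  have hK : ∀ k, k ∈ K ↔ l k ∈ X := fun k => by simp [K]
  have h1 : (K.filter fun k => k < j).card ≤ (intervalMatroid l u).natRk {x ∈ X | x ≤ a} := by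
    refine card_le_natRk_transversalMatroid (g := l) hl.injective.injOn
      (fun k _ => ⟨le_rfl, hlu k⟩) fun k hk => ?_
    rw [Finset.mem_filter, hK] at hk
    exact ⟨hk.1, Fin.le_def.2 (by have := Fin.lt_def.1 (hl hk.2); omega)⟩
  have h2 : (K.filter fun k => i ≤ k).card ≤ (intervalMatroid l u).natRk {x ∈ X | b ≤ x} := by
    refine card_le_natRk_transversalMatroid (g := u) hu.injective.injOn
      (fun k _ => ⟨hlu k, le_rfl⟩) fun k hk => ?_
    rw [Finset.mem_filter, hK] at hk
    have hlt : i₀ < k := Fin.lt_def.2 (by have := Fin.le_def.1 hk.2; omega)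
    exact ⟨hX k _ hk.1 ⟨le_rfl, hlu k⟩ ⟨hlu k, le_rfl⟩,
      Fin.le_def.2 (by have := Fin.lt_def.1 (hu hlt); omega)⟩
  have h3 : (intervalMatroid l u).natRk ({x ∈ X | x ≤ a} ∪ {x ∈ X | b ≤ x}) ≤ K.card := by
    refine natRk_transversalMatroid_le fun x hx k hk => (hK k).2 ?_
    exact hX k x (hx.elim (fun h => h.1) fun h => h.1) hk ⟨le_rfl, hlu k⟩
  have h4 : (K.filter fun k => k < j) ∪ (K.filter fun k => i ≤ k) = K := by
    ext k
    simp only [Finset.mem_union, Finset.mem_filter, ← and_or_left, and_iff_left_iff_imp]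
    exact fun _ => (lt_or_ge k j).imp_right hij.le.trans
  have h5 : (K.filter fun k => k < j) ∩ (K.filter fun k => i ≤ k) = indexRange r i j := by
    ext k
    simp only [Finset.mem_inter, Finset.mem_filter, mem_indexRange, hK]
    exact ⟨fun h => ⟨h.2.2, h.1.2⟩, fun h => ⟨⟨hXij k h.1 h.2 ⟨le_rfl, hlu k⟩, h.2⟩,
      hXij k h.1 h.2 ⟨le_rfl, hlu k⟩, h.1⟩⟩
  have h6 := Finset.card_union_add_card_inter (K.filter fun k => k < j) (K.filter fun k => i ≤ k)
  rw [h4, h5, card_indexRange j.2.le] at h6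
  have h7 : (j : ℕ) - i ≤
      (intervalMatroid l u).natRk ({x ∈ X | x ≤ a} ∩ {x ∈ X | b ≤ x}) := by omega
  -- The intersection has positive rank, so it is nonempty.
  have hba : b ≤ a := by
    by_contra hab
    have hempty : {x ∈ X | x ≤ a} ∩ {x ∈ X | b ≤ x} = ∅ :=
      Set.eq_empty_of_forall_notMem fun x hx => hab (hx.2.2.trans hx.1.2)
    have hij' := Fin.lt_def.1 hij
    rw [hempty, (intervalMatroid l u).empty_indep.natRk_eq_ncard, Set.ncard_empty] at h7
    omega
  constructor
  · refine h7.trans (natRk_mono _ fun x hx => mem_intervalFlat.2 fun k hk hk' => ?_)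
    exact ⟨above x k hx.2.2 hk', below x k hx.1.2 hk⟩
  · refine Set.eq_univ_of_forall fun x => ?_
    rcases le_or_gt x a with hx | hx
    · exact Or.inl (mem_intervalFlat.2 fun k hk _ => ⟨Nat.zero_le _, below x k hx hk⟩)
    · exact Or.inr (mem_intervalFlat.2 fun k _ hk => ⟨above x k (hba.trans hx.le) hk, k.2⟩)

end Intervals

/-! ### Lattice path matroids -/

namespace LatticePathPair

open Matroid

variable {m r : ℕ} (D : LatticePathPair m r)

/-- The position of the `k`-th north step of the upper path, the left endpoint of the `k`-th
interval of the path presentation. -/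
def leftEnd : Fin r → Fin (m + r) := (northSteps D.upper).orderEmbOfFin D.card_upper

/-- The position of the `k`-th north step of the lower path, the right endpoint of the `k`-th
interval of the path presentation. -/
def rightEnd : Fin r → Fin (m + r) := (northSteps D.lower).orderEmbOfFin D.card_lower

lemma strictMono_leftEnd : StrictMono D.leftEnd := OrderEmbedding.strictMono _

lemma strictMono_rightEnd : StrictMono D.rightEnd := OrderEmbedding.strictMono _

lemma matroid_eq_intervalMatroid : D.matroid = intervalMatroid D.leftEnd D.rightEnd := rfl

lemma upper_eq_north_iff (x : Fin (m + r)) :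
    D.upper x = LatticeStep.north ↔ ∃ k, D.leftEnd k = x := by
  have h := Finset.range_orderEmbOfFin (northSteps D.upper) D.card_upper
  have h1 : x ∈ northSteps D.upper ↔ x ∈ Set.range D.leftEnd := by
    rw [leftEnd, h, Finset.mem_coe]
  rw [← Set.mem_range, ← h1]
  simp [northSteps]

lemma lower_eq_north_iff (x : Fin (m + r)) :
    D.lower x = LatticeStep.north ↔ ∃ k, D.rightEnd k = x := by
  have h := Finset.range_orderEmbOfFin (northSteps D.lower) D.card_lower
  have h1 : x ∈ northSteps D.lower ↔ x ∈ Set.range D.rightEnd := by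
    rw [rightEnd, h, Finset.mem_coe]
  rw [← Set.mem_range, ← h1]
  simp [northSteps]

lemma eq_east_of_ne_north {s : LatticeStep} (h : s ≠ LatticeStep.north) : s = LatticeStep.east := by
  cases s
  · exact absurd rfl h
  · rfl

lemma leftEnd_le_rightEnd (k : Fin r) : D.leftEnd k ≤ D.rightEnd k := by
  by_contra! hlt
  have h := D.lower_le_upper (D.rightEnd k + 1) (D.rightEnd k).2
  have h1 : (k : ℕ) + 1 ≤ heightAfter D.lower (D.rightEnd k + 1) := by
    rw [← Fin.card_Iic k, ← Finset.card_image_of_injective _ D.strictMono_rightEnd.injective]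
    refine Finset.card_le_card fun x hx => ?_
    obtain ⟨p, hp, rfl⟩ := Finset.mem_image.1 hx
    have := Fin.le_def.1 (D.strictMono_rightEnd.monotone (Finset.mem_Iic.1 hp))
    refine Finset.mem_filter.2 ⟨?_, by omega⟩
    simpa [northSteps] using (D.lower_eq_north_iff _).2 ⟨p, rfl⟩
  have h2 : heightAfter D.upper (D.rightEnd k + 1) ≤ k := by
    rw [← Fin.card_Iio k, ← Finset.card_image_of_injective _ D.strictMono_leftEnd.injective]
    refine Finset.card_le_card fun x hx => ?_
    obtain ⟨hx1, hx2⟩ := Finset.mem_filter.1 hx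
    obtain ⟨p, rfl⟩ := (D.upper_eq_north_iff x).1 (by simpa [northSteps] using hx1)
    refine Finset.mem_image_of_mem _ (Finset.mem_Iio.2 (D.strictMono_leftEnd.lt_iff_lt.1 ?_))
    have := Fin.lt_def.1 hlt
    exact Fin.lt_def.2 (by omega)
  omega

/-- The flats of the first `j` intervals and of the intervals from `i` on form a modular pair that
covers everything, if `i < j` belong to corners of the lower and of the upper path. Either the
intervals are separated somewhere between `i - 1` and `j`, or the intervals from `i - 1` to `j` lie
in one connected component, which then contains both corners, so that the hypothesis on initial and
final connected flats applies. -/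
lemma modular_intervalFlat_of_corners
    (hmod : ∀ X, D.matroid.IsConnectedComponent X → ∀ A B, D.IsInitialConnectedFlat X A →
      D.IsFinalConnectedFlat X B → (D.matroid.restrict X).IsModularPair A B)
    {i₀ i j₀ j : Fin r} (hi₀ : (i : ℕ) = i₀ + 1) (hj₀ : (j : ℕ) = j₀ + 1) (hij : i < j)
    (hi : (D.rightEnd i : ℕ) ≠ D.rightEnd i₀ + 1) (hj : (D.leftEnd j : ℕ) ≠ D.leftEnd j₀ + 1) :
    (j : ℕ) - i ≤ D.matroid.natRk (intervalFlat D.leftEnd D.rightEnd i j) ∧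
      intervalFlat D.leftEnd D.rightEnd 0 j ∪ intervalFlat D.leftEnd D.rightEnd i r =
        Set.univ := by
  have hl := D.strictMono_leftEnd
  have hu := D.strictMono_rightEnd
  have hlu := D.leftEnd_le_rightEnd
  have hij' := Fin.lt_def.1 hij
  have hi₀i : i₀ < i := Fin.lt_def.2 (by omega)
  have hj₀j : j₀ < j := Fin.lt_def.2 (by omega)
  have hij₀ : i ≤ j₀ := Fin.le_def.2 (by omega)
  by_cases hgap : ∃ k k' : Fin r, i₀ ≤ k ∧ (k' : ℕ) = k + 1 ∧ k' ≤ j ∧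
      D.rightEnd k < D.leftEnd k'
  · obtain ⟨k, k', hk, hkk', hk', hlt⟩ := hgap
    have h1 := Fin.le_def.1 hk
    exact modular_intervalFlat_of_gap hl hu hlu j.2 hkk' hlt (by omega) (Fin.le_def.1 hk')
  push Not at hgap
  obtain ⟨X, hX, hXk⟩ := exists_isConnectedComponent_of_overlap hl hu hlu
    (hi₀i.le.trans hij.le) hgap
  have hlj : D.leftEnd j ≤ D.rightEnd j₀ :=
    hgap j₀ j (hi₀i.le.trans hij₀) hj₀ le_rfl
  have hli : D.leftEnd i ≤ D.rightEnd i₀ := hgap i₀ i le_rfl hi₀ hij.le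
  have hlj' := Fin.lt_def.1 (hl hj₀j)
  have hui' := Fin.lt_def.1 (hu hi₀i)
  -- The corner of the upper path just before its `j`-th north step.
  let a : Fin (m + r) := ⟨D.leftEnd j - 1, by have := (D.leftEnd j).2; omega⟩
  have ha : (D.leftEnd j : ℕ) = (a : ℕ) + 1 := by
    change (D.leftEnd j : ℕ) = (D.leftEnd j - 1) + 1
    omega
  have haX : a ∈ X := hXk j₀ (hi₀i.le.trans hij₀) hj₀j.le
    ⟨Fin.le_def.2 (by omega), (Fin.le_def.2 (by omega) : a ≤ D.leftEnd j).trans hlj⟩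
  have hjX : D.leftEnd j ∈ X := hXk j (hi₀i.le.trans hij.le) le_rfl ⟨le_rfl, hlu j⟩
  have hae : D.upper a = LatticeStep.east := by
    refine eq_east_of_ne_north fun h => ?_
    obtain ⟨k, hk⟩ := (D.upper_eq_north_iff a).1 h
    have h1 : j₀ < k := hl.lt_iff_lt.1 (hk ▸ Fin.lt_def.2 (by omega))
    have h2 : k < j := hl.lt_iff_lt.1 (hk ▸ Fin.lt_def.2 (by omega))
    have := Fin.lt_def.1 h1
    have := Fin.lt_def.1 h2
    omega
  -- The corner of the lower path just after its `i₀`-th north step.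
  let b : Fin (m + r) := ⟨D.rightEnd i₀ + 1, by have := (D.rightEnd i).2; omega⟩
  have hb : (b : ℕ) = (D.rightEnd i₀ : ℕ) + 1 := rfl
  have hbX : b ∈ X := hXk i hi₀i.le hij.le
    ⟨hli.trans (Fin.le_def.2 (by omega)), Fin.le_def.2 (by omega)⟩
  have hiX : D.rightEnd i₀ ∈ X := hXk i₀ le_rfl (hi₀i.le.trans hij.le) ⟨hlu i₀, le_rfl⟩
  have hbe : D.lower b = LatticeStep.east := by
    refine eq_east_of_ne_north fun h => ?_
    obtain ⟨k, hk⟩ := (D.lower_eq_north_iff b).1 h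
    have h1 : i₀ < k := hu.lt_iff_lt.1 (hk ▸ Fin.lt_def.2 (by omega))
    have h2 : k < i := hu.lt_iff_lt.1 (hk ▸ Fin.lt_def.2 (by omega))
    have := Fin.lt_def.1 h1
    have := Fin.lt_def.1 h2
    omega
  have hAB := hmod X hX {x ∈ X | x ≤ a} {x ∈ X | b ≤ x}
    ⟨a, haX, D.leftEnd j, hjX, ha, hae, (D.upper_eq_north_iff _).2 ⟨j, rfl⟩, rfl⟩
    ⟨D.rightEnd i₀, hiX, b, hbX, hb, (D.lower_eq_north_iff _).2 ⟨i₀, rfl⟩, hbe, rfl⟩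
  rw [IsModularPair, restrict_eRk_eq _ (Set.sep_subset _ _),
    restrict_eRk_eq _ (Set.sep_subset _ _),
    restrict_eRk_eq _ (Set.union_subset (Set.sep_subset _ _) (Set.sep_subset _ _)),
    restrict_eRk_eq _ (Set.inter_subset_left.trans (Set.sep_subset _ _)),
    matroid_eq_intervalMatroid] at hAB
  simp only [← coe_natRk] at hAB
  exact modular_intervalFlat_of_modular_restrict hl hu hlu
    (fun k x hx hxk => Icc_subset_of_isConnectedComponent hl hu hlu hX hx hxk) hij
    (fun k hik hkj => hXk k (hi₀i.le.trans hik) hkj.le) hi₀ ha hb (by exact_mod_cast hAB)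

/-- The cyclic parts of the flats of the first `j` intervals and of the intervals from `i` on form a
modular pair, and they meet in loops or contain all circuits together. Indices that do not belong to
corners are replaced by smaller flats with the same cyclic part. -/
lemma modular_cyclicPart_intervalFlat
    (hmod : ∀ X, D.matroid.IsConnectedComponent X → ∀ A B, D.IsInitialConnectedFlat X A →
      D.IsFinalConnectedFlat X B → (D.matroid.restrict X).IsModularPair A B)
    {i j : ℕ} (hi : i ≤ r) (hj : j ≤ r) :
    let A := D.matroid.cyclicPart (intervalFlat D.leftEnd D.rightEnd 0 j)
    let B := D.matroid.cyclicPart (intervalFlat D.leftEnd D.rightEnd i r)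
    D.matroid.natRk A + D.matroid.natRk B ≤ D.matroid.natRk (A ∪ B) + D.matroid.natRk (A ∩ B) ∧
      (A ∩ B ⊆ D.matroid.loops ∨ D.matroid.cyclicPart D.matroid.E ⊆ A ∪ B) := by
  have hl := D.strictMono_leftEnd
  have hu := D.strictMono_rightEnd
  have hlu := D.leftEnd_le_rightEnd
  obtain ⟨d, hd⟩ : ∃ d, j + (r - i) = d := ⟨_, rfl⟩
  induction d using Nat.strong_induction_on generalizing i j with
  | _ d ih =>
  by_cases hcj : ∃ p q : Fin r, (q : ℕ) = j ∧ (q : ℕ) = p + 1 ∧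
      (D.leftEnd q : ℕ) = D.leftEnd p + 1
  · obtain ⟨p, q, rfl, hpq, h⟩ := hcj
    have heq := Set.Subset.antisymm (cyclicPart_intervalFlat_zero_subset hu hpq h)
      (cyclicPart_mono _ (intervalFlat_mono (l := D.leftEnd) (u := D.rightEnd) le_rfl
        (by omega : (p : ℕ) ≤ q)))
    rw [matroid_eq_intervalMatroid, heq]
    exact ih _ (by omega) hi p.2.le rfl
  by_cases hci : ∃ p q : Fin r, (q : ℕ) = i ∧ (q : ℕ) = p + 1 ∧
      (D.rightEnd q : ℕ) = D.rightEnd p + 1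
  · obtain ⟨p, q, rfl, hpq, h⟩ := hci
    have heq := Set.Subset.antisymm (cyclicPart_intervalFlat_top_subset hl hpq h)
      (cyclicPart_mono _ (intervalFlat_mono (l := D.leftEnd) (u := D.rightEnd)
        (Nat.le_succ (q : ℕ)) le_rfl))
    rw [matroid_eq_intervalMatroid, heq]
    have := q.2
    exact ih _ (by omega) q.2 hj rfl
  intro A B
  have hE : ∀ S : Set (Fin (m + r)), S ⊆ D.matroid.E := fun S => Set.subset_univ S
  rcases le_or_gt j i with hji | hij
  · refine ⟨(modular_cyclicPart (hE _) (hE _)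
      (modular_intervalFlat_of_le hl hu hlu hji hi)).1, Or.inl ?_⟩
    have h1 := natRk_le_of_subset_intervalFlat (l := D.leftEnd) (u := D.rightEnd) hj
      (S := A ∩ B) (by
        rw [← intervalFlat_inter]
        exact Set.inter_subset_inter (cyclicPart_subset _ _) (cyclicPart_subset _ _))
    rw [← eRk_eq_zero_iff (hE _), ← coe_natRk]
    rw [matroid_eq_intervalMatroid]
    exact_mod_cast (by omega)
  · obtain ⟨hrk, hcov⟩ : j - i ≤ D.matroid.natRk (intervalFlat D.leftEnd D.rightEnd i j) ∧
        intervalFlat D.leftEnd D.rightEnd 0 j ∪ intervalFlat D.leftEnd D.rightEnd i r =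
          Set.univ := by
      rcases Nat.eq_zero_or_pos i with rfl | hi0
      · rw [intervalFlat_zero_self, Set.union_univ]
        refine ⟨?_, rfl⟩
        rw [← card_indexRange hj]
        refine card_le_natRk_transversalMatroid (g := D.leftEnd) hl.injective.injOn
          (fun k _ => ⟨le_rfl, hlu k⟩) fun k hk => mem_intervalFlat.2 fun k' hk' _ => ?_
        exact ⟨Nat.zero_le _,
          lt_of_le_of_lt (Fin.le_def.1 (hl.le_iff_le.1 hk')) (mem_indexRange.1 hk).2⟩
      rcases hj.eq_or_lt with rfl | hjr
      · rw [intervalFlat_zero_self, Set.univ_union]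
        refine ⟨?_, rfl⟩
        rw [← card_indexRange le_rfl]
        refine card_le_natRk_transversalMatroid (g := D.rightEnd) hu.injective.injOn
          (fun k _ => ⟨hlu k, le_rfl⟩) fun k hk => mem_intervalFlat.2 fun k' _ hk' => ?_
        exact ⟨(mem_indexRange.1 hk).1.trans (Fin.le_def.1 (hu.le_iff_le.1 hk')), k'.2⟩
      · exact D.modular_intervalFlat_of_corners hmod (i₀ := ⟨i - 1, by omega⟩)
          (i := ⟨i, by omega⟩) (j₀ := ⟨j - 1, by omega⟩) (j := ⟨j, hjr⟩)
          (Nat.sub_add_cancel hi0).symm (Nat.sub_add_cancel (by omega : 1 ≤ j)).symm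
          (Fin.lt_def.2 hij)
          (fun h => hci ⟨_, _, rfl, (Nat.sub_add_cancel hi0).symm, h⟩)
          (fun h => hcj ⟨_, _, rfl, (Nat.sub_add_cancel (by omega : 1 ≤ j)).symm, h⟩)
    have h := modular_cyclicPart (M := D.matroid) (hE _) (hE _)
      (modular_intervalFlat hl hlu hij.le hj hrk hcov)
    rw [hcov] at h
    exact ⟨h.1, Or.inr h.2⟩

end LatticePathPair

theorem mainTheorem3 (m r : ℕ) (D : LatticePathPair m r)
    (hmod : ∀ X : Set (Fin (m + r)), D.matroid.IsConnectedComponent X →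
      ∀ A B : Set (Fin (m + r)), D.IsInitialConnectedFlat X A → D.IsFinalConnectedFlat X B →
        (D.matroid.restrict X).IsModularPair A B) :
    D.matroid.ConfigurationUnique := by
  have hl := D.strictMono_leftEnd
  have hu := D.strictMono_rightEnd
  have hlu := D.leftEnd_le_rightEnd
  -- The second chain is indexed by the number of its intervals, which makes it increasing.
  refine Matroid.configurationUnique_of_two_chains r
    (fun j => ⟨D.matroid.cyclicPart (intervalFlat D.leftEnd D.rightEnd 0 j),
      (isFlat_intervalFlat_zero hl hlu j).isCyclicFlat_cyclicPart⟩)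
    (fun t => ⟨D.matroid.cyclicPart (intervalFlat D.leftEnd D.rightEnd (r - t) r),
      (isFlat_intervalFlat_top hu hlu (r - t)).isCyclicFlat_cyclicPart⟩)
    (fun j j' hj => D.matroid.cyclicPart_mono (intervalFlat_mono le_rfl hj))
    (fun t t' ht => D.matroid.cyclicPart_mono (intervalFlat_mono (by omega) le_rfl))
    (fun j hj t _ => (D.modular_cyclicPart_intervalFlat hmod (Nat.sub_le r t) hj).1)
    (fun j hj t _ => ?_) fun C hC => ?_
  · refine (D.modular_cyclicPart_intervalFlat hmod (Nat.sub_le r t) hj).2.imp_left fun h x hx => ?_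
    have hx' : D.matroid.IsCircuit {x} := Matroid.singleton_isCircuit.2 (h hx)
    exact hx'.subset_cyclicPart (Set.singleton_subset_iff.2 hx) rfl
  · obtain ⟨i, j, hi, hj, hcl⟩ := exists_closure_eq_intervalFlat hl hu hlu hC
    refine ⟨j, hj, r - i, Nat.sub_le r i, ?_⟩
    have hcf := hC.isCyclicFlat_closure
    simp only [Nat.sub_sub_self hi]
    refine Set.Subset.antisymm (Set.subset_inter (hcf.subset_cyclicPart ?_)
      (hcf.subset_cyclicPart ?_)) ?_
    · exact hcl.subset.trans (intervalFlat_mono (Nat.zero_le _) le_rfl)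
    · exact hcl.subset.trans (intervalFlat_mono le_rfl hj)
    · refine (Set.inter_subset_inter (D.matroid.cyclicPart_subset _)
        (D.matroid.cyclicPart_subset _)).trans ?_
      rw [intervalFlat_inter]
      exact hcl.superset
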